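/- **Setting.** Let $\Omega\subset\mathbb R^d$ be open and bounded, let $\mathcal K_{\rm src},\mathcal K_{\rm dst}\subset\Omega$ be disjoint compact sets, let $S_1$ be the Euclidean unit sphere, and let $f:\overline\Omega\times S_1\to(0,\infty)$ be continuous, bounded, and Lipschitz continuous in each of its two variables on $\Omega\times S_1$, uniformly in the other one. A trajectory from $x$ on $[0,\tau]$ is a solution of $\dot y=f(y,\alpha)\alpha$, $y(0)=x$, with measurable $\alpha:[0,\tau]\to S_1$ and $y(t)\in\overline\Omega$ on $[0,\tau]$; a reverse trajectory solves $\dot y=-f(y,\alpha)\alpha$ instead. Let $v_{\to d}(x)$ be the infimum of $1-e^{-\tau}$ over the trajectories from $x$ with $y(\tau)\in\mathcal K_{\rm dst}$, and let $v_{s\to}(x)$ be the infimum of $1-e^{-\tau}$ over the reverse trajectories from $x$ with $y(\tau)\in\mathcal K_{\rm src}$ (the value is $1$ if there are none). For a pair $w=(w_s,w_d)$ put $\mathcal F_w=w_s+w_d-w_sw_d$, and write $v=(v_{s\to},v_{\to d})$. For $\eta>0$ let $$\mathcal S_\eta=\{x\in\Omega:\mathcal F_v(x)<\inf_\Omega\mathcal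 F_v+\eta\},\qquad \mathcal O_\eta=\mathcal S_\eta\setminus(\mathcal K_{\rm src}\cup\mathcal K_{\rm dst}).$$ For $\delta\ge0$, let $\Gamma^\delta_x$ be the set of points of the trajectories from $x$ on $[0,\tau]$ with $y(\tau)\in\mathcal K_{\rm dst}$ and $1-e^{-\tau}\le v_{\to d}(x)+\delta$. Let $v^*=\inf_{\mathcal K_{\rm src}}v_{\to d}$, let $\Gamma^*$ be the union of the $\Gamma^0_x$ over the minimizers $x$ of $v_{\to d}$ on $\mathcal K_{\rm src}$, and let the set of $\delta$-geodesic points be $$\Gamma^\delta=\bigcup_{\delta'\in[0,\delta]}\ \bigcup\{\Gamma^{\delta'}_x: x\in\partial\mathcal K_{\rm src},\ v_{\to d}(x)\le v^*+\delta-\delta'\}$$ ($\Gamma^\delta=\emptyset$ for $\delta<0$). Assume that $\Gamma^*\neq\emptyset$ and that $\overline{\mathcal O_{\bar\eta}}\subset\Omega$ for some $\bar\eta>0$. **Scheme.** Fix a set of mesh steps $H>0$ (for instance all of them). For each of them fix a lattice $o_H+H\mathbb Z^d$, with $X^H=(o_H+H\mathbb Z^d)\cap\Omega$; a linear interpolation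 on the lattice, that is, for every $x$, a representation of $x$ as a convex combination of vertices of a closed lattice cell containing $x$, with which values at the vertices are averaged; and two update operators $\mathcal U_{s\to},\mathcal U_{\to d}$ on $[0,1]$-valued grid functions, where the value $1=1-e^{-\infty}$ stands for the time $+\infty$. The update operators are monotone; causal (if $V'$ equals $V$ wherever $V<\mathcal U(V)(y)$, and $V'\ge\mathcal U(V)(y)$ elsewhere, then $\mathcal U(V')(y)=\mathcal U(V)(y)$); and $\mathcal U(1)(y)=1$ for $y$ outside the target, which is $\mathcal K_{\rm src}$ for $\mathcal U_{s\to}$ and $\mathcal K_{\rm dst}$ for $\mathcal U_{\to d}$. Fast marching on a grid $G\subset X^H$: the nodes of the target in $G$ are accepted with value $0$, all other values are $1$; the nodes of $G$ that are not accepted and at which $\mathcal U(\cdot)$ depends on an accepted node form the narrow band and get the value $\mathcal U(V)$; repeatedly, a narrow band node $x^*$ of smallest value is accepted, and all nodes $y\in G$ that are not accepted and at which $\mathcal U(\cdot)(y)$ depends on $x^*$ get the value $\mathcal U(V)(y)$ and enter the narrow band, until the band is empty. For open $\Omega'\subset\Omega$ let $V^{H,\Omega'}_{s\to},V^{H,\Omega'}_{\to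 d}$ be the results on $G=X^H\cap\Omega'$. **Error bound assumption.** There are constants $C_{s\to},C_{\to d},C_{\mathcal O}>0$ and $0<\gamma\le1$ such that, for every mesh step $H$, on $X^H$, $$v_{s\to}-V^{H,\Omega}_{s\to}\le C_{s\to}H^\gamma,\qquad v_{\to d}-V^{H,\Omega}_{\to d}\le C_{\to d}H^\gamma,$$ and, for every open $\Omega'\subset\Omega$, every $\eta>0$ and every mesh step $H$ with $\overline{\mathcal S_\eta}\subset\Omega'$ and $\eta\ge C_{\mathcal O}H^\gamma$, on $X^H\cap\overline{\mathcal S_{\eta/2}}$, $$V^{H,\Omega'}_{s\to}-v_{s\to}\le C_{s\to}H^\gamma,\qquad V^{H,\Omega'}_{\to d}-v_{\to d}\le C_{\to d}H^\gamma.$$ **Multi-level method.** Given $N\ge2$, mesh steps $H_1\ge\dots\ge H_N=h$ and parameters $\eta_1,\dots,\eta_{N-1}>0$, let $G_1=X^{H_1}$. At level $l$, fast marching in both directions on $G_l$ gives $V^{H_l,l}=(V^{H_l,l}_{s\to},V^{H_l,l}_{\to d})$; the active nodes are the nodes $x\in G_l$ accepted in both directions with $\mathcal F_{V^{H_l,l}}(x)\le\min_{G_l}\mathcal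 F_{V^{H_l,l}}+\eta_l$; and $G_{l+1}$ is the set of the $x\in X^{H_{l+1}}$ with $\|x-z\|_\infty\le\max(H_l-H_{l+1},H_{l+1})$ for some active node $z$ of level $l$. Let $V^{H_l,I}$ be the interpolation of $V^{H_l,l}$ (with value $1$ at lattice nodes outside $G_l$), and let the interpolated active region be $$O^{H_l,I}_{\eta_l}=\{x\in\Omega\setminus(\mathcal K_{\rm src}\cup\mathcal K_{\rm dst}):\mathcal F_{V^{H_l,I}}(x)<\min_{G_l}\mathcal F_{V^{H_l,l}}+\eta_l\}.$$ **Theorem.** For every $\theta\in(0,1)$ there exist constants $C_\eta,\kappa,H_0>0$ such that, for every $N\ge2$ and all mesh steps $H_1\ge\dots\ge H_N=h$ with $H_1\le H_0$ and $H_l/H_{l+1}\ge\kappa$ for $1\le l<N$, the multi-level method with $\eta_l=C_\eta H_l^\gamma$ has the following properties for every $l\in\{1,\dots,N-1\}$. 1. $\overline{\mathcal O_{\eta_l/2}}\subset\overline{O^{H_l,I}_{\eta_l}}$, and for every $\delta<\eta_l/2$, $\ \Gamma^\delta\setminus\operatorname{int}(\mathcal K_{\rm src}\cup\mathcal K_{\rm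 dst})\subset\overline{\mathcal O_{\eta_l/2}}$. 2. For every $\delta\le\theta\,\eta_l/2$ and every $x\in X^{H_{l+1}}\cap\Gamma^\delta$, the node $x$ belongs to $G_{l+1}$ and $$|V^{H_{l+1},l+1}_{\to d}(x)-v_{\to d}(x)|\le C_{\to d}H_{l+1}^\gamma,\qquad |V^{H_{l+1},l+1}_{s\to}(x)-v_{s\to}(x)|\le C_{s\to}H_{l+1}^\gamma.$$ Consequently $V^{h,N}_{\to d}$ converges to $v_{\to d}$ as $h\to0$: for every $\varepsilon>0$ there is $h_0>0$ such that, for all $N$ and all mesh steps as above with $h=H_N\le h_0$, all $\delta\le\theta\,\eta_{N-1}/2$ and all $x\in X^h\cap\Gamma^\delta$, $|V^{h,N}_{\to d}(x)-v_{\to d}(x)|\le\varepsilon$. -/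

import Mathlib

open Set MeasureTheory

noncomputable section

namespace FastMarching

/-- Points of `ℝ^d` with the Euclidean norm. -/
abbrev Pt (d : ℕ) := EuclideanSpace ℝ (Fin d)

/-! ### The continuous minimum time problem -/

/-- Data of a minimum time problem: domain, speed function, source and destination. -/
structure Problem (d : ℕ) where
  Ω : Set (Pt d)
  f : Pt d → Pt d → ℝ
  Ksrc : Set (Pt d)
  Kdst : Set (Pt d)

/-- The standing assumptions: `Ω` is open and bounded, the source and the destination are disjoint
compact subsets of `Ω`, and the speed is positive, continuous, bounded on `closure Ω × S₁`, and
Lipschitz continuous in the position and in the direction. -/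
structure Problem.Regular {d : ℕ} (P : Problem d) : Prop where
  isOpen : IsOpen P.Ω
  isBounded : Bornology.IsBounded P.Ω
  src_compact : IsCompact P.Ksrc
  dst_compact : IsCompact P.Kdst
  src_subset : P.Ksrc ⊆ P.Ω
  dst_subset : P.Kdst ⊆ P.Ω
  disjoint : Disjoint P.Ksrc P.Kdst
  speed_cont : ContinuousOn (fun p : Pt d × Pt d => P.f p.1 p.2)
    (closure P.Ω ×ˢ Metric.sphere (0 : Pt d) 1)
  speed_pos : ∀ x ∈ closure P.Ω, ∀ a ∈ Metric.sphere (0 : Pt d) 1, 0 < P.f x a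
  speed_bdd : ∃ M : ℝ, 0 < M ∧
    ∀ x ∈ closure P.Ω, ∀ a ∈ Metric.sphere (0 : Pt d) 1, |P.f x a| ≤ M
  speed_lip_pos : ∃ L : ℝ, 0 < L ∧ ∀ a ∈ Metric.sphere (0 : Pt d) 1,
    ∀ x ∈ P.Ω, ∀ x' ∈ P.Ω, |P.f x a - P.f x' a| ≤ L * ‖x - x'‖
  speed_lip_dir : ∃ L : ℝ, 0 < L ∧ ∀ x ∈ P.Ω,
    ∀ a ∈ Metric.sphere (0 : Pt d) 1, ∀ a' ∈ Metric.sphere (0 : Pt d) 1,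
      |P.f x a - P.f x a'| ≤ L * ‖a - a'‖

/-- `y` solves `y' = σ f(y, α) α`, `y(0) = x` on `[0, τ]` (in integral form) with a measurable
control `α` with values in the unit sphere, and stays in `closure Ω`.
The forward dynamics is `σ = 1`, the reverse dynamics is `σ = -1`. -/
structure Problem.IsTrajectory {d : ℕ} (P : Problem d) (σ τ : ℝ) (x : Pt d) (α y : ℝ → Pt d) :
    Prop where
  measurable : Measurable α
  control : ∀ t ∈ Icc (0 : ℝ) τ, ‖α t‖ = 1
  cont : ContinuousOn y (Icc (0 : ℝ) τ)
  state : ∀ t ∈ Icc (0 : ℝ) τ, y t ∈ closure P.Ω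
  dynamics : ∀ t ∈ Icc (0 : ℝ) τ, y t = x + ∫ s in (0 : ℝ)..t, (σ * P.f (y s) (α s)) • α s

/-- Value function of the discounted problem: the infimum of `∫₀^τ e^{-t} dt = 1 - e^{-τ}` over the
trajectories from `x` which are in `K` at time `τ`. It equals `1 - e^{-T}` for the minimum time `T`,
so it is `1` when `K` cannot be reached (`T = +∞`). -/
def Problem.value {d : ℕ} (P : Problem d) (σ : ℝ) (K : Set (Pt d)) (x : Pt d) : ℝ :=
  sInf (insert 1 {r : ℝ | ∃ (τ : ℝ) (α y : ℝ → Pt d), 0 ≤ τ ∧ P.IsTrajectory σ τ x α y ∧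
    y τ ∈ K ∧ r = 1 - Real.exp (-τ)})

/-- The value function "to destination". -/
def Problem.vd {d : ℕ} (P : Problem d) (x : Pt d) : ℝ := P.value 1 P.Kdst x

/-- The value function "from source" (reverse dynamics, target `Ksrc`). -/
def Problem.vs {d : ℕ} (P : Problem d) (x : Pt d) : ℝ := P.value (-1) P.Ksrc x

/-- The combination `a + b - a b` of the two value functions. -/
def combine (a b : ℝ) : ℝ := a + b - a * b

/-- The function `F_v`. -/
def Problem.Fv {d : ℕ} (P : Problem d) (x : Pt d) : ℝ := combine (P.vs x) (P.vd x)

/-- The points `x` of `Ω` with `F_v(x) < inf_Ω F_v + η`. -/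
def Problem.sublevel {d : ℕ} (P : Problem d) (η : ℝ) : Set (Pt d) :=
  {x | x ∈ P.Ω ∧ P.Fv x < sInf (P.Fv '' P.Ω) + η}

/-- The neighborhood `O_η`. -/
def Problem.nbhd {d : ℕ} (P : Problem d) (η : ℝ) : Set (Pt d) :=
  P.sublevel η \ (P.Ksrc ∪ P.Kdst)

/-- The `δ`-geodesic points starting from `x`. -/
def Problem.geodesicsFrom {d : ℕ} (P : Problem d) (δ : ℝ) (x : Pt d) : Set (Pt d) :=
  {z | ∃ (τ : ℝ) (α y : ℝ → Pt d), 0 ≤ τ ∧ P.IsTrajectory 1 τ x α y ∧ y τ ∈ P.Kdst ∧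
    1 - Real.exp (-τ) ≤ P.vd x + δ ∧ ∃ t ∈ Icc (0 : ℝ) τ, z = y t}

/-- The set `Γ*` of geodesic points from `Ksrc` to `Kdst`: points of the optimal trajectories that
start at the minimizers of `vd` over `Ksrc`. -/
def Problem.geodesics {d : ℕ} (P : Problem d) : Set (Pt d) :=
  {z | ∃ x ∈ P.Ksrc, (∀ x' ∈ P.Ksrc, P.vd x ≤ P.vd x') ∧ z ∈ P.geodesicsFrom 0 x}

/-- The optimal value `v* = inf_{Ksrc} vd`. -/
def Problem.vstar {d : ℕ} (P : Problem d) : ℝ := sInf (P.vd '' P.Ksrc)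

/-- The set `Γ^δ` of `δ`-geodesic points from `Ksrc` to `Kdst`. -/
def Problem.deltaGeodesics {d : ℕ} (P : Problem d) (δ : ℝ) : Set (Pt d) :=
  {z | ∃ δ' ∈ Icc (0 : ℝ) δ, ∃ x ∈ frontier P.Ksrc,
    P.vd x ≤ P.vstar + (δ - δ') ∧ z ∈ P.geodesicsFrom δ' x}

/-! ### Fast marching -/

/-- `U(·)(y)` depends on the value at the node `x`. -/
def DependsOn {d : ℕ} (U : (Pt d → unitInterval) → Pt d → unitInterval) (y x : Pt d) : Prop :=
  ∃ V V' : Pt d → unitInterval, (∀ z, z ≠ x → V z = V' z) ∧ U V y ≠ U V' y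

/-- Update operators for the target `K`: monotone and causal (the updated value depends only on
strictly smaller values). Grid functions take values in `[0,1]`, and the value `1 = 1 - e^{-∞}` means
"time `+∞`"; outside the target, the update without any information is `+∞`. -/
structure IsUpdateOperator {d : ℕ} (K : Set (Pt d))
    (U : (Pt d → unitInterval) → Pt d → unitInterval) : Prop where
  mono : Monotone U
  causal : ∀ (V V' : Pt d → unitInterval) (y : Pt d),
    (∀ x, V x < U V y → V' x = V x) → (∀ x, U V y ≤ V x → U V y ≤ V' x) → U V' y = U V y
  top : ∀ y, y ∉ K → U (fun _ => 1) y = 1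

/-- State of the fast marching algorithm: current values, accepted nodes, narrow band. -/
structure MarchState (d : ℕ) where
  val : Pt d → unitInterval
  accepted : Set (Pt d)
  narrow : Set (Pt d)

open Classical in
/-- Initialization: the starting nodes are accepted with value `0`, all other values are `+∞`
(that is, `1`), then the nodes of `G` depending on starting nodes enter the narrow band and get their
first value. -/
def marchInit {d : ℕ} (U : (Pt d → unitInterval) → Pt d → unitInterval)
    (G start : Set (Pt d)) : MarchState d :=
  let V₀ : Pt d → unitInterval := fun x => if x ∈ start then 0 else 1
  let N : Set (Pt d) := {y | y ∈ G ∧ y ∉ start ∧ ∃ x ∈ start, DependsOn U y x}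
  { val := fun y => if y ∈ N then U V₀ y else V₀ y
    accepted := start
    narrow := N }

open Classical in
/-- One pass of the loop, which runs while the narrow band is not empty and not all nodes of `ending`
are accepted: a node `x` of the narrow band with the smallest value is accepted, and the nodes of `G`
which are not accepted and depend on `x` are updated and put in the narrow band. -/
def marchStep {d : ℕ} (U : (Pt d → unitInterval) → Pt d → unitInterval)
    (G ending : Set (Pt d)) (s : MarchState d) : MarchState d :=
  if h : (∃ x ∈ s.narrow, ∀ y ∈ s.narrow, s.val x ≤ s.val y) ∧ ¬ ending ⊆ s.accepted then
    let x := h.1.choose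
    let A : Set (Pt d) := insert x s.accepted
    let D : Set (Pt d) := {y | y ∈ G ∧ y ∉ A ∧ DependsOn U y x}
    { val := fun y => if y ∈ D then U s.val y else s.val y
      accepted := A
      narrow := (s.narrow \ {x}) ∪ D }
  else s

/-- The fast marching method on the finite grid `G`. Every effective pass accepts a new node of `G`,
so the loop ends after at most `card G` passes. -/
def march {d : ℕ} (U : (Pt d → unitInterval) → Pt d → unitInterval)
    (G start ending : Set (Pt d)) : MarchState d :=
  (marchStep U G ending)^[G.ncard] (marchInit U G start)

/-! ### Grids, interpolation, discretization scheme -/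

/-- The lattice of mesh step `H` through the point `o`. -/
def lattice {d : ℕ} (o : Pt d) (H : ℝ) : Set (Pt d) :=
  {x | ∃ k : Fin d → ℤ, ∀ i, x i = o i + H * (k i : ℝ)}

/-- Linear interpolation on the lattice: every point is written as a convex combination of vertices
of a closed cell of the lattice (with side `H`) that contains it. -/
def IsLinearInterpolation {d : ℕ} (o : Pt d) (H : ℝ) (w : Pt d → (Pt d →₀ ℝ)) : Prop :=
  ∀ x : Pt d,
    (∃ k : Fin d → ℤ,
      (∀ i, o i + H * (k i : ℝ) ≤ x i ∧ x i ≤ o i + H * ((k i : ℝ) + 1)) ∧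
      ∀ y ∈ (w x).support, ∀ i, y i = o i + H * (k i : ℝ) ∨ y i = o i + H * ((k i : ℝ) + 1)) ∧
    (∀ y, 0 ≤ w x y) ∧
    ((w x).sum fun _ c => c) = 1 ∧
    ((w x).sum fun y c => c • y) = x

/-- The interpolation at `x` of a grid function. -/
def interpolate {d : ℕ} (w : Pt d → (Pt d →₀ ℝ)) (V : Pt d → unitInterval) (x : Pt d) : ℝ :=
  (w x).sum fun y c => c * (V y : ℝ)

/-- A discretization: the mesh steps in use and, for each of them, the position of the lattice, the
update operators in both directions, and a linear interpolation. -/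
structure Scheme (d : ℕ) where
  steps : Set ℝ
  origin : ℝ → Pt d
  Us : ℝ → (Pt d → unitInterval) → Pt d → unitInterval
  Ud : ℝ → (Pt d → unitInterval) → Pt d → unitInterval
  weight : ℝ → Pt d → (Pt d →₀ ℝ)

structure Scheme.Lawful {d : ℕ} (S : Scheme d) (P : Problem d) : Prop where
  steps_pos : ∀ H ∈ S.steps, 0 < H
  src : ∀ H ∈ S.steps, IsUpdateOperator P.Ksrc (S.Us H)
  dst : ∀ H ∈ S.steps, IsUpdateOperator P.Kdst (S.Ud H)
  interp : ∀ H ∈ S.steps, IsLinearInterpolation (S.origin H) H (S.weight H)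

/-- The grid `X^H` of mesh step `H` in `Ω`. -/
def Scheme.grid {d : ℕ} (S : Scheme d) (P : Problem d) (H : ℝ) : Set (Pt d) :=
  lattice (S.origin H) H ∩ P.Ω

/-- Fast marching "from source" on the grid `G` of mesh step `H`. -/
def Scheme.marchS {d : ℕ} (S : Scheme d) (P : Problem d) (H : ℝ) (G : Set (Pt d)) : MarchState d :=
  march (S.Us H) G (P.Ksrc ∩ G) G

/-- Fast marching "to destination" on the grid `G` of mesh step `H`. -/
def Scheme.marchD {d : ℕ} (S : Scheme d) (P : Problem d) (H : ℝ) (G : Set (Pt d)) : MarchState d :=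
  march (S.Ud H) G (P.Kdst ∩ G) G

/-- The computed approximation of `vs` on the grid `G`. -/
def Scheme.Vs {d : ℕ} (S : Scheme d) (P : Problem d) (H : ℝ) (G : Set (Pt d)) (x : Pt d) : ℝ :=
  ((S.marchS P H G).val x : ℝ)

/-- The computed approximation of `vd` on the grid `G`. -/
def Scheme.Vd {d : ℕ} (S : Scheme d) (P : Problem d) (H : ℝ) (G : Set (Pt d)) (x : Pt d) : ℝ :=
  ((S.marchD P H G).val x : ℝ)

/-- The computed approximation of `F_v` on the grid `G`. -/
def Scheme.FV {d : ℕ} (S : Scheme d) (P : Problem d) (H : ℝ) (G : Set (Pt d)) (x : Pt d) : ℝ :=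
  combine (S.Vs P H G x) (S.Vd P H G x)

/-- The error bound assumed of the scheme, with constants `Cs`, `Cd`, `CO` and exponent `γ`:
a lower bound for the computation on the whole grid, and an upper bound for the computations
restricted to open subsets `Ω'` of `Ω` containing a neighborhood of the geodesics. -/
structure Scheme.ErrorBound {d : ℕ} (S : Scheme d) (P : Problem d) (Cs Cd CO γ : ℝ) : Prop where
  lower : ∀ H ∈ S.steps, ∀ x ∈ S.grid P H,
    P.vs x - S.Vs P H (S.grid P H) x ≤ Cs * H ^ γ ∧
    P.vd x - S.Vd P H (S.grid P H) x ≤ Cd * H ^ γ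
  upper : ∀ Ω' : Set (Pt d), IsOpen Ω' → Ω' ⊆ P.Ω →
    ∀ η : ℝ, 0 < η → ∀ H ∈ S.steps, closure (P.sublevel η) ⊆ Ω' → CO * H ^ γ ≤ η →
      ∀ x ∈ S.grid P H ∩ closure (P.sublevel (η / 2)),
        S.Vs P H (S.grid P H ∩ Ω') x - P.vs x ≤ Cs * H ^ γ ∧
        S.Vd P H (S.grid P H ∩ Ω') x - P.vd x ≤ Cd * H ^ γ

/-! ### The multi-level method -/

/-- Active nodes of the grid `G` of mesh step `H`, for the parameter `η`. -/
def Scheme.active {d : ℕ} (S : Scheme d) (P : Problem d) (H η : ℝ) (G : Set (Pt d)) :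
    Set (Pt d) :=
  {x | x ∈ G ∧ x ∈ (S.marchS P H G).accepted ∧ x ∈ (S.marchD P H G).accepted ∧
    ∀ y ∈ G, S.FV P H G x ≤ S.FV P H G y + η}

/-- The fine grid of mesh step `h` around the active nodes `A` of mesh step `H`. -/
def Scheme.fine {d : ℕ} (S : Scheme d) (P : Problem d) (H h : ℝ) (A : Set (Pt d)) : Set (Pt d) :=
  {x | x ∈ S.grid P h ∧ ∃ z ∈ A, ∀ i, |x i - z i| ≤ max (H - h) h}

/-- The grid of level `l ≥ 1` for the mesh steps `H 1, H 2, …` and the parameters `η 1, η 2, …`. -/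
def Scheme.levelGrid {d : ℕ} (S : Scheme d) (P : Problem d) (H η : ℕ → ℝ) : ℕ → Set (Pt d)
  | 0 => ∅
  | 1 => S.grid P (H 1)
  | l + 2 => S.fine P (H (l + 1)) (H (l + 2))
      (S.active P (H (l + 1)) (η (l + 1)) (S.levelGrid P H η (l + 1)))

/-- Approximation of `vs` computed at level `l`. -/
def Scheme.levelVs {d : ℕ} (S : Scheme d) (P : Problem d) (H η : ℕ → ℝ) (l : ℕ) (x : Pt d) : ℝ :=
  S.Vs P (H l) (S.levelGrid P H η l) x

/-- Approximation of `vd` computed at level `l`. -/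
def Scheme.levelVd {d : ℕ} (S : Scheme d) (P : Problem d) (H η : ℕ → ℝ) (l : ℕ) (x : Pt d) : ℝ :=
  S.Vd P (H l) (S.levelGrid P H η l) x

/-- The interpolated active region of level `l`: the points of `Ω \ (Ksrc ∪ Kdst)` at which the
combination of the two interpolated approximations is smaller than its minimum over the nodes of the
level plus `η l`. -/
def Scheme.activeRegion {d : ℕ} (S : Scheme d) (P : Problem d) (H η : ℕ → ℝ) (l : ℕ) :
    Set (Pt d) :=
  {x | x ∈ P.Ω \ (P.Ksrc ∪ P.Kdst) ∧ ∀ y ∈ S.levelGrid P H η l,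
    combine
        (interpolate (S.weight (H l)) (S.marchS P (H l) (S.levelGrid P H η l)).val x)
        (interpolate (S.weight (H l)) (S.marchD P (H l) (S.levelGrid P H η l)).val x)
      < S.FV P (H l) (S.levelGrid P H η l) y + η l}

/-- `H 1 ≥ H 2 ≥ … ≥ H N` are mesh steps of the scheme, with `H 1 ≤ H₀` and ratios of at least
`κ`. -/
structure Scheme.IsMeshSequence {d : ℕ} (S : Scheme d) (κ H₀ : ℝ) (N : ℕ) (H : ℕ → ℝ) : Prop where
  two_le : 2 ≤ N
  mem : ∀ l, 1 ≤ l → l ≤ N → H l ∈ S.steps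
  anti : ∀ l, 1 ≤ l → l < N → H (l + 1) ≤ H l
  ratio : ∀ l, 1 ≤ l → l < N → κ ≤ H l / H (l + 1)
  first_le : H 1 ≤ H₀

end FastMarching

end

/-! The proof propagates an inclusion of grids from level to level, never an error. Monotonicity and
causality make the output of fast marching a fixed point of the update on the grid, away from the
target. Comparing two fixed points at a smallest bad value then shows that shrinking the grid can
only raise the values (`march_anti`). If a grid `G ⊆ X^H` contains the nodes of an open sublevel set
`S_ζ` of `F_v`, its values are therefore squeezed between those on `X^H` and those on `X^H ∩ S_ζ`.
The assumed lower bound applies to the first and, where `ζ` leaves enough room, the assumed upper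
bound to the second (`Scheme.Covers.lower`, `Scheme.Covers.upper`).

The inclusion passes to the next level because the value functions are Lipschitz away from the
boundary: a short segment is travelled in a time proportional to its length (`value_le_value_add`).
With `η = Cη H^γ` large against the discretization errors and the `O(H)` displacement, every coarse
node close to `S_{(1-ε)η}` is active, so the next grid contains all fine nodes of `S_{(1-ε)η}`
(`Scheme.Covers.fine`). The ratio `κ = 16^{1/γ}` makes this height at least `8` times the next `η`,
which closes the induction (`levelGrid_covers`).

Geodesics enter through `1 - F_v = (1 - v_s)(1 - v_d)`: exponentials of times multiply under
concatenation, so `F_v(x)` is the optimal cost of passing through `x`. Hence `v* ≤ F_v` everywhere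
(`vstar_le_Fv`), and `F_v ≤ v* + δ` on `Γ^δ`, so that `Γ^δ ⊆ S_η` for `δ < η` when `closure S_η ⊆ Ω`
(`deltaGeodesics_subset`). -/

namespace FastMarching

variable {d : ℕ}

/-! ### Analysis of the fast marching loop -/

/-- `DependsOn` tests one node at a time, so the values on `T` are exchanged one by one; this is why
`T` has to be finite. -/
lemma eq_of_not_dependsOn {U : (Pt d → unitInterval) → Pt d → unitInterval} {y : Pt d}
    {T : Set (Pt d)} (hT : T.Finite) (hd : ∀ x ∈ T, ¬ DependsOn U y x)
    {V V' : Pt d → unitInterval} (h : ∀ z ∉ T, V z = V' z) : U V y = U V' y := by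
  classical
  induction T, hT using Set.Finite.induction_on generalizing V with
  | empty => rw [show V = V' from funext fun z => h z (by simp)]
  | @insert a T _ _ ih =>
    have h1 : U V y = U (Function.update V a (V' a)) y := by
      by_contra hne
      refine hd a (mem_insert _ _) ⟨V, _, fun z hz => ?_, hne⟩
      simp [Function.update_of_ne hz]
    rw [h1]
    refine ih (fun x hx => hd x (mem_insert_of_mem _ hx)) fun z hz => ?_
    by_cases hza : z = a
    · subst hza; simp
    · rw [Function.update_of_ne hza]
      exact h z (by simp [hza, hz])

open Classical in
/-- The grid function that keeps the accepted values only. -/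
noncomputable def MarchState.frozen (s : MarchState d) : Pt d → unitInterval :=
  fun x => if x ∈ s.accepted then s.val x else 1

lemma MarchState.val_le_frozen (s : MarchState d) : s.val ≤ s.frozen := by
  intro x
  unfold MarchState.frozen
  split_ifs
  · exact le_rfl
  · exact unitInterval.le_one'

/-- The loop invariant of fast marching. -/
structure MarchInvariant (U : (Pt d → unitInterval) → Pt d → unitInterval)
    (G start : Set (Pt d)) (s : MarchState d) : Prop where
  start_subset : start ⊆ s.accepted
  start_val : ∀ x ∈ start, s.val x = 0
  accepted_subset : s.accepted ⊆ G
  narrow_subset : s.narrow ⊆ G \ s.accepted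
  far : ∀ y ∉ s.accepted, y ∉ s.narrow → s.val y = 1
  super : ∀ y ∉ start, U s.val y ≤ s.val y
  sub : ∀ y ∈ G \ s.accepted, s.val y ≤ U s.frozen y
  order : ∀ z ∈ s.accepted, ∀ y ∉ s.accepted, s.val z ≤ s.val y
  fixed : ∀ y ∈ s.accepted \ start, U s.val y = s.val y

lemma marchInit_invariant {K : Set (Pt d)} {U : (Pt d → unitInterval) → Pt d → unitInterval}
    (hU : IsUpdateOperator K U) {G : Set (Pt d)} (hG : G.Finite) :
    MarchInvariant U G (K ∩ G) (marchInit U G (K ∩ G)) := by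
  classical
  set start := K ∩ G with hstart
  set V₀ : Pt d → unitInterval := fun x => if x ∈ start then 0 else 1 with hV₀
  set N : Set (Pt d) := {y | y ∈ G ∧ y ∉ start ∧ ∃ x ∈ start, DependsOn U y x} with hN
  have hval : (marchInit U G start).val = fun y => if y ∈ N then U V₀ y else V₀ y := by
    funext y
    simp only [marchInit, hN, hV₀]
    congr!
  have hacc : (marchInit U G start).accepted = start := rfl
  have hnar : (marchInit U G start).narrow = N := rfl
  have hs0 : ∀ x ∈ start, (marchInit U G start).val x = 0 := by
    intro x hx
    rw [hval]
    have : x ∉ N := fun h => h.2.1 hx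
    simp [this, hV₀, hx]
  have hfar : ∀ y ∉ start, y ∉ N → (marchInit U G start).val y = 1 := by
    intro y hy hyN
    simp [hval, hyN, hV₀, hy]
  have hle : (marchInit U G start).val ≤ V₀ := by
    intro y
    rw [hval]
    by_cases hy : y ∈ N
    · simp only [hy, if_true, hV₀, hy.2.1, if_false]; exact unitInterval.le_one'
    · simp [hy]
  have hfro : (marchInit U G start).frozen = V₀ := by
    funext x
    unfold MarchState.frozen
    rw [hacc]
    by_cases hx : x ∈ start
    · rw [if_pos hx, hs0 x hx]; simp [hV₀, hx]
    · simp [hV₀, hx]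
  refine ⟨le_rfl, hs0, inter_subset_right, fun y hy => ⟨hy.1, hy.2.1⟩, hfar, ?_, ?_, ?_, ?_⟩
  · intro y hy
    by_cases hyN : y ∈ N
    · have : (marchInit U G start).val y = U V₀ y := by simp [hval, hyN]
      rw [this]
      exact hU.mono hle y
    · rw [hfar y hy hyN]; exact unitInterval.le_one'
  · intro y hy
    rw [hfro]
    by_cases hyN : y ∈ N
    · simp [hval, hyN]
    · rw [hfar y hy.2 hyN]
      have h1 : U V₀ y = U (fun _ => 1) y := by
        refine eq_of_not_dependsOn (hG.subset (inter_subset_right : K ∩ G ⊆ G)) ?_ ?_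
        · intro x hx hd
          exact hyN ⟨hy.1, hy.2, x, hx, hd⟩
        · intro z hz
          have : z ∉ start := hz
          simp [hV₀, this]
      rw [h1, hU.top y fun hyK => hy.2 ⟨hyK, hy.1⟩]
  · intro z hz y _
    rw [hs0 z hz]; exact unitInterval.nonneg'
  · intro y hy
    exact absurd hy.1 hy.2

/-- If a non-accepted node would get a value below all non-accepted values, then its value is
determined by the accepted nodes. -/
lemma MarchInvariant.le_update {K : Set (Pt d)}
    {U : (Pt d → unitInterval) → Pt d → unitInterval}
    (hU : IsUpdateOperator K U) {G start : Set (Pt d)} {s : MarchState d}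
    (hs : MarchInvariant U G start s) {x y : Pt d} (hx : ∀ z ∉ s.accepted, s.val x ≤ s.val z)
    (hy : y ∈ G \ s.accepted) : s.val x ≤ U s.val y := by
  by_contra! hlt
  have h1 : U s.frozen y = U s.val y := by
    refine hU.causal s.val s.frozen y (fun z hz => ?_) (fun z hz => hz.trans (s.val_le_frozen z))
    have hzA : z ∈ s.accepted := by
      by_contra hzA
      exact absurd (hx z hzA) (not_le.2 (hz.trans hlt))
    simp [MarchState.frozen, hzA]
  have h2 := hs.sub y hy
  rw [h1] at h2
  exact absurd (hx y hy.2) (not_le.2 (h2.trans_lt hlt))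

/-- Values only decrease, which preserves `super` by monotonicity. The order of acceptance rests on
`MarchInvariant.le_update`: an update never falls below the value being accepted. By causality,
later updates then cannot disturb the equation at accepted nodes. -/
lemma marchStep_invariant {K : Set (Pt d)} {U : (Pt d → unitInterval) → Pt d → unitInterval}
    (hU : IsUpdateOperator K U) {G start ending : Set (Pt d)} {s : MarchState d}
    (hs : MarchInvariant U G start s) : MarchInvariant U G start (marchStep U G ending s) := by
  classical
  by_cases h : (∃ x ∈ s.narrow, ∀ y ∈ s.narrow, s.val x ≤ s.val y) ∧ ¬ ending ⊆ s.accepted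
  swap
  · rw [marchStep, dif_neg h]; exact hs
  set x := h.1.choose with hx
  obtain ⟨hxN, hxmin⟩ : x ∈ s.narrow ∧ ∀ y ∈ s.narrow, s.val x ≤ s.val y := h.1.choose_spec
  set A : Set (Pt d) := insert x s.accepted with hA
  set D : Set (Pt d) := {y | y ∈ G ∧ y ∉ A ∧ DependsOn U y x} with hD
  have hstep : marchStep U G ending s =
      { val := fun y => if y ∈ D then U s.val y else s.val y
        accepted := A
        narrow := (s.narrow \ {x}) ∪ D } := by
    rw [marchStep, dif_pos h]
  set s' := marchStep U G ending s with hs'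
  have hval : s'.val = fun y => if y ∈ D then U s.val y else s.val y := by rw [hstep]
  have hacc : s'.accepted = A := by rw [hstep]
  have hnar : s'.narrow = (s.narrow \ {x}) ∪ D := by rw [hstep]
  have hxG : x ∈ G \ s.accepted := hs.narrow_subset hxN
  have hmin : ∀ z ∉ s.accepted, s.val x ≤ s.val z := by
    intro z hz
    by_cases hzN : z ∈ s.narrow
    · exact hxmin z hzN
    · rw [hs.far z hz hzN]; exact unitInterval.le_one'
  have hvD : ∀ y ∈ D, s'.val y = U s.val y := fun y hy => by simp [hval, hy]
  have hvn : ∀ y ∉ D, s'.val y = s.val y := fun y hy => by simp [hval, hy]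
  have hvA : ∀ y ∈ A, s'.val y = s.val y := fun y hy => hvn y fun hyD => hyD.2.1 hy
  have hsA : s.accepted ⊆ A := subset_insert _ _
  have hxstart : x ∉ start := fun hx => hxG.2 (hs.start_subset hx)
  have hle : s'.val ≤ s.val := by
    intro y
    by_cases hy : y ∈ D
    · rw [hvD y hy]
      exact hs.super y fun hys => hy.2.1 (hsA (hs.start_subset hys))
    · rw [hvn y hy]
  have hDx : ∀ y ∈ D, s.val x ≤ s'.val y := fun y hy => by
    rw [hvD y hy]
    exact hs.le_update hU hmin ⟨hy.1, fun hyA => hy.2.1 (hsA hyA)⟩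
  have hxge : ∀ z ∈ A, s.val z ≤ s.val x := by
    rintro z (rfl | hz)
    · exact le_rfl
    · exact hs.order z hz x hxG.2
  refine ⟨?_, ?_, ?_, ?_, ?_, ?_, ?_, ?_, ?_⟩
  · rw [hacc]; exact hs.start_subset.trans hsA
  · intro y hy
    rw [hvA y (hsA (hs.start_subset hy))]; exact hs.start_val y hy
  · rw [hacc]; exact insert_subset hxG.1 hs.accepted_subset
  · rw [hacc, hnar]
    rintro y (hy | hy)
    · refine ⟨(hs.narrow_subset hy.1).1, ?_⟩
      rintro (h1 | h1)
      · exact hy.2 h1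
      · exact (hs.narrow_subset hy.1).2 h1
    · exact ⟨hy.1, hy.2.1⟩
  · rw [hacc, hnar]
    intro y hyA hyN
    have hyD : y ∉ D := fun h1 => hyN (Or.inr h1)
    rw [hvn y hyD]
    refine hs.far y (fun h1 => hyA (hsA h1)) fun h1 => hyN (Or.inl ⟨h1, fun h2 => hyA ?_⟩)
    exact Or.inl h2
  · intro y hy
    refine (hU.mono hle y).trans ?_
    by_cases hyD : y ∈ D
    · rw [hvD y hyD]
    · rw [hvn y hyD]; exact hs.super y hy
  · rw [hacc]
    intro y hy
    by_cases hyD : y ∈ D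
    · rw [hvD y hyD]
      refine hU.mono (fun z => ?_) y
      unfold MarchState.frozen
      rw [hacc]
      split_ifs with hz
      · rw [hvA z hz]
      · exact unitInterval.le_one'
    · rw [hvn y hyD]
      -- The two frozen functions differ at most at `x`, and `y ∉ D` means that the update at `y`
      -- ignores `x`.
      have h1 : U s'.frozen y = U s.frozen y := by
        refine eq_of_not_dependsOn (finite_singleton x) ?_ ?_
        · rintro z rfl hd
          exact hyD ⟨hy.1, hy.2, hd⟩
        · intro z hz
          have hzx : z ≠ x := hz
          unfold MarchState.frozen
          rw [hacc]
          by_cases hzA : z ∈ s.accepted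
          · rw [if_pos (hsA hzA), if_pos hzA, hvA z (hsA hzA)]
          · rw [if_neg hzA, if_neg]
            rintro (h1 | h1)
            · exact hzx h1
            · exact hzA h1
      rw [h1]
      exact hs.sub y ⟨hy.1, fun h1 => hy.2 (hsA h1)⟩
  · rw [hacc]
    intro z hz y hy
    rw [hvA z hz]
    by_cases hyD : y ∈ D
    · exact (hxge z hz).trans (hDx y hyD)
    · rw [hvn y hyD]
      exact (hxge z hz).trans (hmin y fun h1 => hy (hsA h1))
  · rw [hacc]
    rintro y ⟨hyA, hyS⟩
    have hfix : U s.val y = s.val y := by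
      rcases hyA with rfl | hyA
      · exact le_antisymm (hs.super _ hyS) (hs.le_update hU hmin hxG)
      · exact hs.fixed y ⟨hyA, hyS⟩
    rw [hvA y hyA, ← hfix]
    -- Values below `s.val y` sit at accepted nodes and are unchanged; the new values on `D` are at
    -- least `s.val x ≥ s.val y`.
    refine hU.causal s.val s'.val y (fun z hz => ?_) (fun z hz => ?_)
    · refine hvA z ?_
      by_contra hzA
      rw [hfix] at hz
      exact absurd ((hxge y hyA).trans (hmin z fun h1 => hzA (hsA h1))) (not_le.2 hz)
    · by_cases hzD : z ∈ D
      · rw [hfix]; exact (hxge y hyA).trans (hDx z hzD)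
      · rw [hvn z hzD]; exact hz

lemma marchStep_ncard {U : (Pt d → unitInterval) → Pt d → unitInterval}
    {G start : Set (Pt d)} (hG : G.Finite) {s : MarchState d}
    (hs : MarchInvariant U G start s) (hne : s.narrow.Nonempty) :
    (marchStep U G G s).accepted.ncard = s.accepted.ncard + 1 := by
  classical
  have h : (∃ x ∈ s.narrow, ∀ y ∈ s.narrow, s.val x ≤ s.val y) ∧ ¬ G ⊆ s.accepted := by
    constructor
    · exact Set.exists_min_image s.narrow s.val (hG.subset fun y hy => (hs.narrow_subset hy).1) hne
    · obtain ⟨y, hy⟩ := hne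
      exact fun h => (hs.narrow_subset hy).2 (h (hs.narrow_subset hy).1)
  have hxN : h.1.choose ∈ s.narrow := h.1.choose_spec.1
  rw [marchStep, dif_pos h]
  exact ncard_insert_of_notMem (hs.narrow_subset hxN).2 (hG.subset hs.accepted_subset)

lemma marchStep_of_narrow_empty {U : (Pt d → unitInterval) → Pt d → unitInterval}
    {G ending : Set (Pt d)} {s : MarchState d} (h : s.narrow = ∅) :
    marchStep U G ending s = s := by
  rw [marchStep, dif_neg]
  rintro ⟨⟨x, hx, -⟩, -⟩
  simp [h] at hx

lemma march_invariant {K : Set (Pt d)} {U : (Pt d → unitInterval) → Pt d → unitInterval}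
    (hU : IsUpdateOperator K U) {G : Set (Pt d)} (hG : G.Finite) :
    MarchInvariant U G (K ∩ G) (march U G (K ∩ G) G) ∧ (march U G (K ∩ G) G).narrow = ∅ := by
  -- After `n` passes the band is empty or at least `n` nodes are accepted. For `n = G.ncard` the
  -- second case means that all of `G` is accepted, and the band is again empty.
  have key : ∀ n : ℕ, MarchInvariant U G (K ∩ G)
      ((marchStep U G G)^[n] (marchInit U G (K ∩ G))) ∧
      (((marchStep U G G)^[n] (marchInit U G (K ∩ G))).narrow = ∅ ∨
        n ≤ ((marchStep U G G)^[n] (marchInit U G (K ∩ G))).accepted.ncard) := by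
    intro n
    induction n with
    | zero => exact ⟨marchInit_invariant hU hG, Or.inr (Nat.zero_le _)⟩
    | succ n ih =>
      rw [Function.iterate_succ_apply']
      refine ⟨marchStep_invariant hU ih.1, ?_⟩
      rcases Set.eq_empty_or_nonempty
        ((marchStep U G G)^[n] (marchInit U G (K ∩ G))).narrow with h | h
      · left; rw [marchStep_of_narrow_empty h]; exact h
      · right
        rw [marchStep_ncard hG ih.1 h]
        rcases ih.2 with h1 | h1
        · exact absurd h1 h.ne_empty
        · omega
  obtain ⟨h1, h2⟩ := key G.ncard
  refine ⟨h1, ?_⟩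
  rcases h2 with h2 | h2
  · exact h2
  · have heq := Set.eq_of_subset_of_ncard_le h1.accepted_subset h2 hG
    refine Set.eq_empty_of_forall_notMem fun y hy => ?_
    have := h1.narrow_subset hy
    rw [heq] at this
    exact this.2 this.1

lemma march_mem_accepted {K : Set (Pt d)} {U : (Pt d → unitInterval) → Pt d → unitInterval}
    (hU : IsUpdateOperator K U) {G : Set (Pt d)} (hG : G.Finite) {y : Pt d}
    (hy : (march U G (K ∩ G) G).val y < 1) : y ∈ (march U G (K ∩ G) G).accepted := by
  obtain ⟨h, hn⟩ := march_invariant hU hG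
  by_contra hyA
  exact hy.ne (h.far y hyA (by simp [hn]))

/-- At accepted nodes this is the invariant. The other nodes carry the value `1` once the band is
empty, so `s.frozen = s.val` and the two one-sided inequalities `super` and `sub` meet. -/
lemma march_fixed {K : Set (Pt d)} {U : (Pt d → unitInterval) → Pt d → unitInterval}
    (hU : IsUpdateOperator K U) {G : Set (Pt d)} (hG : G.Finite) {y : Pt d}
    (hy : y ∈ G) (hyK : y ∉ K) :
    U (march U G (K ∩ G) G).val y = (march U G (K ∩ G) G).val y := by
  obtain ⟨h, hn⟩ := march_invariant hU hG
  set s := march U G (K ∩ G) G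
  have hyS : y ∉ K ∩ G := fun h => hyK h.1
  by_cases hyA : y ∈ s.accepted
  · exact h.fixed y ⟨hyA, hyS⟩
  · refine le_antisymm (h.super y hyS) ?_
    have hfro : s.frozen = s.val := by
      funext x
      unfold MarchState.frozen
      split_ifs with hx
      · rfl
      · exact (h.far x hx (by simp [hn])).symm
    have := h.sub y ⟨hy, hyA⟩
    rwa [hfro] at this

/-- The values computed by fast marching decrease when the grid is enlarged. -/
lemma march_anti {K : Set (Pt d)} {U : (Pt d → unitInterval) → Pt d → unitInterval}
    (hU : IsUpdateOperator K U) {G G' : Set (Pt d)} (hGG : G ⊆ G') (hG' : G'.Finite) (x : Pt d) :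
    (march U G' (K ∩ G') G').val x ≤ (march U G (K ∩ G) G).val x := by
  have hG := hG'.subset hGG
  have hfix := fun y => march_fixed (y := y) hU hG
  have hfix' := fun y => march_fixed (y := y) hU hG'
  have hs := (march_invariant hU hG).1
  have hs' := (march_invariant hU hG').1
  have hacc := fun y => march_mem_accepted (y := y) hU hG
  set V := (march U G (K ∩ G) G).val
  set V' := (march U G' (K ∩ G') G').val
  have hsub : {y | V y < V' y} ⊆ G := fun y hy =>
    hs.accepted_subset (hacc y (lt_of_lt_of_le hy unitInterval.le_one'))
  by_contra! hx
  -- Take a counterexample with the smallest `V`. Below `V y` there is none, so `V ⊔ V'` agrees with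
  -- `V` there; causality and monotonicity then give `V' y ≤ V y`.
  obtain ⟨y, hy, hmin⟩ := Set.exists_min_image {y | V y < V' y} V (hG.subset hsub) ⟨x, hx⟩
  have hyG := hsub hy
  have hyK : y ∉ K := by
    intro hyK
    have h0 : V' y = 0 := hs'.start_val y ⟨hyK, hGG hyG⟩
    have hy' : V y < V' y := hy
    rw [h0] at hy'
    exact absurd hy' (not_lt.2 unitInterval.nonneg')
  have hW : U (V ⊔ V') y = U V y := by
    refine hU.causal V (V ⊔ V') y (fun z hz => ?_) (fun z hz => hz.trans le_sup_left)
    rw [hfix y hyG hyK] at hz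
    refine sup_eq_left.2 ?_
    by_contra! hlt
    exact absurd (hmin z hlt) (not_le.2 hz)
  have hle : U V' y ≤ U (V ⊔ V') y := hU.mono le_sup_right y
  rw [hW, hfix y hyG hyK, hfix' y (hGG hyG) hyK] at hle
  exact absurd hle (not_le.2 hy)

end FastMarching

namespace FastMarching

variable {d : ℕ}

/-! ### Trajectories -/

/-- The speed is controlled only on `closure Ω × S₁`. Its extension by zero is Borel, since this set
is closed, and it agrees with the speed along the trajectory, where the bound on the speed gives
integrability. -/
lemma Problem.IsTrajectory.integrableOn {P : Problem d} (hP : P.Regular) {σ τ : ℝ} {x : Pt d}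
    {α y : ℝ → Pt d} (h : P.IsTrajectory σ τ x α y) :
    IntegrableOn (fun s => (σ * P.f (y s) (α s)) • α s) (Icc 0 τ) := by
  classical
  obtain ⟨M, -, hM⟩ := hP.speed_bdd
  set D : Set (Pt d × Pt d) := closure P.Ω ×ˢ Metric.sphere (0 : Pt d) 1 with hD
  have hDm : MeasurableSet D := (isClosed_closure.prod Metric.isClosed_sphere).measurableSet
  set F : Pt d × Pt d → ℝ := D.piecewise (fun p => P.f p.1 p.2) (fun _ => 0) with hF
  have hFm : Measurable F :=
    hP.speed_cont.measurable_piecewise continuousOn_const hDm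
  have hmem : ∀ s ∈ Icc (0 : ℝ) τ, (y s, α s) ∈ D := fun s hs =>
    ⟨h.state s hs, by simpa using h.control s hs⟩
  have hym : AEMeasurable y (volume.restrict (Icc 0 τ)) := h.cont.aemeasurable measurableSet_Icc
  have hFy : AEMeasurable (fun s => F (y s, α s)) (volume.restrict (Icc 0 τ)) :=
    hFm.comp_aemeasurable (hym.prodMk h.measurable.aemeasurable)
  have hG : AEMeasurable (fun s => (σ * F (y s, α s)) • α s) (volume.restrict (Icc 0 τ)) :=
    (hFy.const_mul σ).smul h.measurable.aemeasurable
  have hGi : IntegrableOn (fun s => (σ * F (y s, α s)) • α s) (Icc 0 τ) := by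
    refine Integrable.of_bound hG.aestronglyMeasurable (|σ| * M) ?_
    refine (ae_restrict_iff' measurableSet_Icc).2 (Filter.Eventually.of_forall fun s hs => ?_)
    have h1 : F (y s, α s) = P.f (y s) (α s) := by simp [hF, hmem s hs]
    rw [norm_smul, h.control s hs, mul_one, h1, norm_mul, Real.norm_eq_abs, Real.norm_eq_abs]
    exact mul_le_mul_of_nonneg_left (hM _ (hmem s hs).1 _ (hmem s hs).2) (abs_nonneg _)
  refine hGi.congr_fun (fun s hs => ?_) measurableSet_Icc
  simp [hF, hmem s hs]

lemma Problem.IsTrajectory.intervalIntegrable {P : Problem d} (hP : P.Regular) {σ τ : ℝ} {x : Pt d}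
    {α y : ℝ → Pt d} (h : P.IsTrajectory σ τ x α y) {a b : ℝ} (ha : a ∈ Icc 0 τ)
    (hb : b ∈ Icc 0 τ) :
    IntervalIntegrable (fun s => (σ * P.f (y s) (α s)) • α s) volume a b :=
  ((h.integrableOn hP).mono_set ((convex_Icc (0 : ℝ) τ).ordConnected.uIcc_subset ha hb)).intervalIntegrable

lemma Problem.IsTrajectory.init {P : Problem d} {σ τ : ℝ} {x : Pt d}
    {α y : ℝ → Pt d} (h : P.IsTrajectory σ τ x α y) (hτ : 0 ≤ τ) : y 0 = x := by
  simpa using h.dynamics 0 ⟨le_rfl, hτ⟩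

lemma Problem.IsTrajectory.restrict {P : Problem d} {σ τ : ℝ} {x : Pt d}
    {α y : ℝ → Pt d} (h : P.IsTrajectory σ τ x α y) {t : ℝ} (ht : t ≤ τ) :
    P.IsTrajectory σ t x α y where
  measurable := h.measurable
  control s hs := h.control s ⟨hs.1, hs.2.trans ht⟩
  cont := h.cont.mono (Icc_subset_Icc_right ht)
  state s hs := h.state s ⟨hs.1, hs.2.trans ht⟩
  dynamics s hs := h.dynamics s ⟨hs.1, hs.2.trans ht⟩

/-- Time reversal. -/
lemma Problem.IsTrajectory.reverse {P : Problem d} (hP : P.Regular) {σ τ : ℝ} {x : Pt d}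
    {α y : ℝ → Pt d} (h : P.IsTrajectory σ τ x α y) :
    P.IsTrajectory (-σ) τ (y τ) (fun t => α (τ - t)) (fun t => y (τ - t)) := by
  have hmem : ∀ t ∈ Icc (0 : ℝ) τ, τ - t ∈ Icc (0 : ℝ) τ := fun t ht =>
    ⟨by linarith [ht.2], by linarith [ht.1]⟩
  refine ⟨h.measurable.comp (measurable_const.sub measurable_id), fun t ht => h.control _ (hmem t ht),
    h.cont.comp (by fun_prop) hmem, fun t ht => h.state _ (hmem t ht), fun t ht => ?_⟩
  have hτ : τ ∈ Icc (0 : ℝ) τ := ⟨ht.1.trans ht.2, le_rfl⟩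
  have h0 : (0 : ℝ) ∈ Icc (0 : ℝ) τ := ⟨le_rfl, hτ.1⟩
  have e1 := h.dynamics τ hτ
  have e2 := h.dynamics _ (hmem t ht)
  have e3 := intervalIntegral.integral_add_adjacent_intervals
    (h.intervalIntegrable hP h0 (hmem t ht)) (h.intervalIntegrable hP (hmem t ht) hτ)
  have e4 : ∫ s in (0 : ℝ)..t, (-σ * P.f (y (τ - s)) (α (τ - s))) • α (τ - s) =
      - ∫ s in (τ - t)..τ, (σ * P.f (y s) (α s)) • α s := by
    have := intervalIntegral.integral_comp_sub_left (a := 0) (b := t)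
      (fun s => (σ * P.f (y s) (α s)) • α s) τ
    rw [sub_zero] at this
    rw [← this, ← intervalIntegral.integral_neg]
    simp only [neg_mul, neg_smul]
  beta_reduce
  rw [e4, e2, e1, ← e3]
  abel

/-- The part of a trajectory after the time `t`. -/
lemma Problem.IsTrajectory.tail {P : Problem d} (hP : P.Regular) {σ τ : ℝ} {x : Pt d}
    {α y : ℝ → Pt d} (h : P.IsTrajectory σ τ x α y) {t : ℝ} (ht : 0 ≤ t) :
    ∃ α' y', P.IsTrajectory σ (τ - t) (y t) α' y' ∧ y' (τ - t) = y τ := by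
  -- A tail is the reversal of an initial piece of the reversed trajectory.
  have h1 := ((h.reverse hP).restrict (t := τ - t) (by linarith)).reverse hP
  rw [neg_neg] at h1
  exact ⟨fun s => α (τ - (τ - t - s)), fun s => y (τ - (τ - t - s)), by simpa using h1, by simp⟩

lemma Problem.IsTrajectory.concat {P : Problem d} (hP : P.Regular) {σ τ₁ τ₂ : ℝ} {x : Pt d}
    {α₁ y₁ α₂ y₂ : ℝ → Pt d} (h₁ : P.IsTrajectory σ τ₁ x α₁ y₁)
    (h₂ : P.IsTrajectory σ τ₂ (y₁ τ₁) α₂ y₂) (hτ₁ : 0 ≤ τ₁) (hτ₂ : 0 ≤ τ₂) :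
    ∃ α y, P.IsTrajectory σ (τ₁ + τ₂) x α y ∧ y (τ₁ + τ₂) = y₂ τ₂ := by
  have hinit := h₂.init hτ₂
  set α : ℝ → Pt d := fun s => if s ≤ τ₁ then α₁ s else α₂ (s - τ₁) with hα
  set y : ℝ → Pt d := fun s => if s ≤ τ₁ then y₁ s else y₂ (s - τ₁) with hy
  have hα1 : ∀ s ≤ τ₁, α s = α₁ s := fun s hs => by simp [hα, hs]
  have hα2 : ∀ s, τ₁ < s → α s = α₂ (s - τ₁) := fun s hs => by simp [hα, hs]
  have hy1 : ∀ s ≤ τ₁, y s = y₁ s := fun s hs => by simp [hy, hs]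
  have hy2 : ∀ s, τ₁ ≤ s → y s = y₂ (s - τ₁) := fun s hs => by
    rcases hs.eq_or_lt with rfl | hs
    · simp [hy, hinit]
    · simp [hy, hs]
  have hI1 : ∀ t ≤ τ₁, 0 ≤ t → ∫ s in (0 : ℝ)..t, (σ * P.f (y s) (α s)) • α s =
      ∫ s in (0 : ℝ)..t, (σ * P.f (y₁ s) (α₁ s)) • α₁ s := by
    intro t ht ht0
    refine intervalIntegral.integral_congr fun s hs => ?_
    rw [uIcc_of_le ht0] at hs
    beta_reduce
    rw [hα1 s (hs.2.trans ht), hy1 s (hs.2.trans ht)]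
  have hI2 : ∀ t, τ₁ ≤ t → ∫ s in τ₁..t, (σ * P.f (y s) (α s)) • α s =
      ∫ s in (0 : ℝ)..(t - τ₁), (σ * P.f (y₂ s) (α₂ s)) • α₂ s := by
    intro t ht
    have := intervalIntegral.integral_comp_sub_right (a := τ₁) (b := t)
      (fun s => (σ * P.f (y₂ s) (α₂ s)) • α₂ s) τ₁
    rw [sub_self] at this
    rw [← this]
    -- Open interval: at the junction `τ₁` the control is still `α₁`.
    refine intervalIntegral.integral_congr_uIoo fun s hs => ?_
    rw [uIoo_of_le ht] at hs
    beta_reduce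
    rw [hα2 s hs.1, hy2 s hs.1.le]
  have hi1 : ∀ t ≤ τ₁, 0 ≤ t →
      IntervalIntegrable (fun s => (σ * P.f (y s) (α s)) • α s) volume 0 t := by
    intro t ht ht0
    refine (h₁.intervalIntegrable hP ⟨le_rfl, hτ₁⟩ ⟨ht0, ht⟩).congr fun s hs => ?_
    rw [uIoc_of_le ht0] at hs
    beta_reduce
    rw [hα1 s (hs.2.trans ht), hy1 s (hs.2.trans ht)]
  have hi2 : ∀ t, τ₁ ≤ t → t ≤ τ₁ + τ₂ →
      IntervalIntegrable (fun s => (σ * P.f (y s) (α s)) • α s) volume τ₁ t := by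
    intro t ht ht'
    have := (h₂.intervalIntegrable hP (a := 0) (b := t - τ₁) ⟨le_rfl, hτ₂⟩
      ⟨by linarith, by linarith⟩).comp_sub_right τ₁
    rw [zero_add, sub_add_cancel] at this
    refine this.congr fun s hs => ?_
    rw [uIoc_of_le ht] at hs
    beta_reduce
    rw [hα2 s hs.1, hy2 s hs.1.le]
  refine ⟨α, y, ⟨?_, ?_, ?_, ?_, ?_⟩, ?_⟩
  · exact Measurable.ite measurableSet_Iic h₁.measurable
      (h₂.measurable.comp (measurable_id.sub measurable_const))
  · intro t ht
    rcases le_or_gt t τ₁ with h | h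
    · rw [hα1 t h]; exact h₁.control t ⟨ht.1, h⟩
    · rw [hα2 t h]; exact h₂.control _ ⟨by linarith, by linarith [ht.2]⟩
  · rw [← Icc_union_Icc_eq_Icc hτ₁ (by linarith : τ₁ ≤ τ₁ + τ₂)]
    refine ContinuousOn.union_of_isClosed ?_ ?_ isClosed_Icc isClosed_Icc
    · exact h₁.cont.congr fun s hs => hy1 s hs.2
    · refine (h₂.cont.comp (f := fun s => s - τ₁) (by fun_prop) fun s hs => ?_).congr
        fun s hs => hy2 s hs.1
      exact ⟨by linarith [hs.1], by linarith [hs.2]⟩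
  · intro t ht
    rcases le_or_gt t τ₁ with h | h
    · rw [hy1 t h]; exact h₁.state t ⟨ht.1, h⟩
    · rw [hy2 t h.le]; exact h₂.state _ ⟨by linarith, by linarith [ht.2]⟩
  · intro t ht
    rcases le_or_gt t τ₁ with h | h
    · rw [hy1 t h, hI1 t h ht.1]; exact h₁.dynamics t ⟨ht.1, h⟩
    · rw [hy2 t h.le, ← intervalIntegral.integral_add_adjacent_intervals (hi1 τ₁ le_rfl hτ₁)
        (hi2 t h.le ht.2), hI1 τ₁ le_rfl hτ₁, hI2 t h.le, ← add_assoc,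
        ← h₁.dynamics τ₁ ⟨hτ₁, le_rfl⟩]
      exact h₂.dynamics _ ⟨by linarith, by linarith [ht.2]⟩
  · rw [hy2 _ (by linarith), add_sub_cancel_left]

/-- An autonomous scalar differential equation with a continuous right-hand side between two
positive bounds has a global solution. -/
lemma exists_scalar_solution {g : ℝ → ℝ} (hg : Continuous g) {c M : ℝ} (hc : 0 < c)
    (hcg : ∀ r, c ≤ g r) (hgM : ∀ r, g r ≤ M) :
    ∃ ρ : ℝ → ℝ, ρ 0 = 0 ∧ ∀ t, HasDerivAt ρ (g (ρ t)) t := by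
  have hpos : ∀ r, 0 < g r := fun r => hc.trans_le (hcg r)
  have hM : 0 < M := (hpos 0).trans_le (hgM 0)
  have hinv : Continuous fun r => (g r)⁻¹ := hg.inv₀ fun r => (hpos r).ne'
  -- Separation of variables: `φ` is the time needed to reach position `r`, and the solution is its
  -- inverse. The bound `g ≤ M` makes `φ` grow at least like `r / M`, hence onto.
  set φ : ℝ → ℝ := fun r => ∫ s in (0 : ℝ)..r, (g s)⁻¹ with hφ
  have hφd : ∀ r, HasDerivAt φ (g r)⁻¹ r := fun r =>
    intervalIntegral.integral_hasDerivAt_right (hinv.intervalIntegrable _ _)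
      (hinv.stronglyMeasurableAtFilter _ _) hinv.continuousAt
  have hφ0 : φ 0 = 0 := by simp [hφ]
  have hφc : Continuous φ := continuous_iff_continuousAt.2 fun r => (hφd r).continuousAt
  have hmono : StrictMono φ := strictMono_of_hasDerivAt_pos hφd fun r => inv_pos.2 (hpos r)
  have hψ : Monotone fun r => φ r - M⁻¹ * r := by
    refine monotone_of_hasDerivAt_nonneg (f' := fun r => (g r)⁻¹ - M⁻¹ * 1)
      (fun r => (hφd r).sub ((hasDerivAt_id r).const_mul _)) fun r => ?_
    have := inv_anti₀ (hpos r) (hgM r)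
    simpa using this
  have hsurj : Function.Surjective φ := by
    refine hφc.surjective ?_ ?_
    · refine Filter.tendsto_atTop_mono' _ ?_
        (Filter.tendsto_id.const_mul_atTop (inv_pos.2 hM))
      filter_upwards [Filter.eventually_ge_atTop 0] with r hr
      have := hψ hr
      simp only [hφ0, mul_zero, sub_zero] at this
      simpa using this
    · refine Filter.tendsto_atBot_mono' _ ?_
        (Filter.tendsto_id.const_mul_atBot (inv_pos.2 hM))
      filter_upwards [Filter.eventually_le_atBot 0] with r hr
      have := hψ hr
      simp only [hφ0, mul_zero, sub_zero] at this
      simpa using this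
  set e := hmono.orderIsoOfSurjective φ hsurj
  have he : ∀ t, φ (e.symm t) = t := fun t => e.apply_symm_apply t
  refine ⟨e.symm, ?_, fun t => ?_⟩
  · exact hmono.injective (by rw [he, hφ0])
  · have := HasDerivAt.of_local_left_inverse (f := φ) (g := e.symm) (a := t)
      e.symm.continuous.continuousAt (hφd _) (inv_pos.2 (hpos _)).ne'
      (Filter.Eventually.of_forall he)
    simpa using this

/-- A positive lower bound of the speed. -/
lemma Problem.Regular.exists_speed_ge {P : Problem d} (hP : P.Regular) :
    ∃ c : ℝ, 0 < c ∧ ∀ x ∈ closure P.Ω, ∀ a ∈ Metric.sphere (0 : Pt d) 1, c ≤ P.f x a := by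
  have hK : IsCompact (closure P.Ω ×ˢ Metric.sphere (0 : Pt d) 1) :=
    hP.isBounded.isCompact_closure.prod (isCompact_sphere _ _)
  obtain ⟨c, hc, h⟩ := hK.exists_forall_le' hP.speed_cont (a := 0)
    (fun p hp => hP.speed_pos p.1 hp.1 p.2 hp.2)
  exact ⟨c, hc, fun x hx a ha => h (x, a) ⟨hx, ha⟩⟩

/-- The segment between two points is travelled in a time proportional to its length. -/
lemma Problem.Regular.exists_segment_trajectory {P : Problem d} (hP : P.Regular) {c : ℝ}
    (hc : 0 < c)
    (hcf : ∀ x ∈ closure P.Ω, ∀ a ∈ Metric.sphere (0 : Pt d) 1, c ≤ P.f x a) {σ : ℝ}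
    (hσ : σ * σ = 1) {x x' : Pt d} (hne : x ≠ x') (hseg : segment ℝ x x' ⊆ P.Ω) :
    ∃ τ α y, 0 ≤ τ ∧ τ ≤ ‖x' - x‖ / c ∧ P.IsTrajectory σ τ x α y ∧ y τ = x' := by
  obtain ⟨M, -, hM⟩ := hP.speed_bdd
  set n : ℝ := ‖x' - x‖ with hn
  have hn0 : 0 < n := norm_pos_iff.2 (sub_ne_zero.2 hne.symm)
  set u : Pt d := n⁻¹ • (x' - x) with hu
  have hun : ‖u‖ = 1 := by
    rw [hu, norm_smul, norm_inv, Real.norm_eq_abs, abs_of_pos hn0, ← hn,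
      inv_mul_cancel₀ hn0.ne']
  have hσn : |σ| = 1 := by
    rw [← sq_eq_sq₀ (abs_nonneg _) zero_le_one, sq_abs, sq, hσ, one_pow]
  -- The control is `σ • u`, so that the velocity `σ f • (σ • u)` equals `f • u` for both signs.
  have hau : ‖σ • u‖ = 1 := by rw [norm_smul, hun, Real.norm_eq_abs, hσn, one_mul]
  have hau' : σ • u ∈ Metric.sphere (0 : Pt d) 1 := by simpa using hau
  have hpt : ∀ r ∈ Icc (0 : ℝ) n, x + r • u ∈ P.Ω := by
    intro r hr
    refine hseg ?_
    rw [segment_eq_image']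
    refine ⟨r / n, ⟨div_nonneg hr.1 hn0.le, (div_le_one hn0).2 hr.2⟩, ?_⟩
    simp only [hu, smul_smul, div_eq_mul_inv]
  -- Clamping to `[0, n]` makes the scalar equation global; the solution is used only until it
  -- reaches `n`.
  set cl : ℝ → ℝ := fun r => max 0 (min r n) with hcl
  have hclm : ∀ r, cl r ∈ Icc (0 : ℝ) n := fun r =>
    ⟨le_max_left _ _, max_le hn0.le (min_le_right _ _)⟩
  have hclid : ∀ r ∈ Icc (0 : ℝ) n, cl r = r := fun r hr => by
    simp [hcl, min_eq_left hr.2, max_eq_right hr.1]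
  set g : ℝ → ℝ := fun r => P.f (x + cl r • u) (σ • u) with hg
  have hclos : ∀ r, x + cl r • u ∈ closure P.Ω := fun r => subset_closure (hpt _ (hclm r))
  have hgc : Continuous g := by
    have : Continuous fun r => (x + cl r • u, σ • u) := by fun_prop
    exact hP.speed_cont.comp_continuous this fun r => ⟨hclos r, hau'⟩
  obtain ⟨ρ, hρ0, hρd⟩ := exists_scalar_solution hgc hc (fun r => hcf _ (hclos r) _ hau')
    (fun r => (le_abs_self _).trans (hM _ (hclos r) _ hau'))
  have hgpos : ∀ r, c ≤ g r := fun r => hcf _ (hclos r) _ hau'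
  have hρc : Continuous ρ := continuous_iff_continuousAt.2 fun r => (hρd r).continuousAt
  have hρm : Monotone ρ := monotone_of_hasDerivAt_nonneg hρd fun r => hc.le.trans (hgpos _)
  have hψ : Monotone fun t => ρ t - c * t := by
    refine monotone_of_hasDerivAt_nonneg (f' := fun t => g (ρ t) - c * 1)
      (fun t => (hρd t).sub ((hasDerivAt_id t).const_mul _)) fun t => ?_
    simpa using hgpos _
  have hnc : 0 ≤ n / c := div_nonneg hn0.le hc.le
  have hρn : n ≤ ρ (n / c) := by
    have := hψ hnc
    simp only [hρ0, mul_zero, sub_zero] at this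
    rw [mul_div_cancel₀ _ hc.ne'] at this
    linarith
  obtain ⟨τ, hτ, hρτ⟩ := intermediate_value_Icc hnc hρc.continuousOn
    (show n ∈ Icc (ρ 0) (ρ (n / c)) from ⟨hρ0.trans_le hn0.le, hρn⟩)
  have hρI : ∀ t ∈ Icc (0 : ℝ) τ, ρ t ∈ Icc (0 : ℝ) n := fun t ht =>
    ⟨hρ0.ge.trans (hρm ht.1), (hρm ht.2).trans hρτ.le⟩
  refine ⟨τ, fun _ => σ • u, fun t => x + ρ t • u, hτ.1, hτ.2,
    ⟨measurable_const, fun _ _ => hau, by fun_prop,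
      fun t ht => subset_closure (hpt _ (hρI t ht)), fun t ht => ?_⟩, ?_⟩
  · have e1 : ∫ s in (0 : ℝ)..t, (σ * P.f (x + ρ s • u) (σ • u)) • σ • u =
        ∫ s in (0 : ℝ)..t, g (ρ s) • u := by
      refine intervalIntegral.integral_congr fun s hs => ?_
      rw [uIcc_of_le ht.1] at hs
      simp only [hg]
      rw [hclid _ (hρI s ⟨hs.1, hs.2.trans ht.2⟩), smul_smul, mul_right_comm, hσ, one_mul]
    have e2 : ∫ s in (0 : ℝ)..t, g (ρ s) = ρ t - ρ 0 :=
      intervalIntegral.integral_eq_sub_of_hasDerivAt (fun s _ => hρd s)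
        ((hgc.comp hρc).intervalIntegrable _ _)
    beta_reduce
    rw [e1, intervalIntegral.integral_smul_const, e2, hρ0, sub_zero]
  · beta_reduce
    rw [hρτ, hu, smul_smul, mul_inv_cancel₀ hn0.ne', one_smul, add_sub_cancel]

end FastMarching

namespace FastMarching

variable {d : ℕ}

/-! ### The value functions -/

lemma value_bddBelow (P : Problem d) (σ : ℝ) (K : Set (Pt d)) (x : Pt d) :
    0 ∈ lowerBounds (insert 1 {r : ℝ | ∃ (τ : ℝ) (α y : ℝ → Pt d), 0 ≤ τ ∧
      P.IsTrajectory σ τ x α y ∧ y τ ∈ K ∧ r = 1 - Real.exp (-τ)}) := by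
  rintro r (rfl | ⟨τ, α, y, hτ, -, -, rfl⟩)
  · exact zero_le_one
  · have : Real.exp (-τ) ≤ 1 := Real.exp_le_one_iff.2 (by linarith)
    linarith

lemma value_nonneg (P : Problem d) (σ : ℝ) (K : Set (Pt d)) (x : Pt d) : 0 ≤ P.value σ K x :=
  le_csInf (insert_nonempty _ _) fun _ hr => value_bddBelow P σ K x hr

lemma value_le_one (P : Problem d) (σ : ℝ) (K : Set (Pt d)) (x : Pt d) : P.value σ K x ≤ 1 :=
  csInf_le ⟨0, value_bddBelow P σ K x⟩ (mem_insert _ _)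

lemma value_le {P : Problem d} {σ τ : ℝ} {K : Set (Pt d)} {x : Pt d} {α y : ℝ → Pt d}
    (hτ : 0 ≤ τ) (h : P.IsTrajectory σ τ x α y) (hy : y τ ∈ K) :
    P.value σ K x ≤ 1 - Real.exp (-τ) :=
  csInf_le ⟨0, value_bddBelow P σ K x⟩ (mem_insert_of_mem _ ⟨τ, α, y, hτ, h, hy, rfl⟩)

/-- The bound `r ≤ 1` excludes the inserted default value `1`, which comes with no trajectory. -/
lemma exists_trajectory_of_value_lt {P : Problem d} {σ r : ℝ} {K : Set (Pt d)} {x : Pt d}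
    (h : P.value σ K x < r) (hr : r ≤ 1) :
    ∃ (τ : ℝ) (α y : ℝ → Pt d), 0 ≤ τ ∧ P.IsTrajectory σ τ x α y ∧ y τ ∈ K ∧
      1 - Real.exp (-τ) < r := by
  obtain ⟨s, hs, hsr⟩ := exists_lt_of_csInf_lt (insert_nonempty _ _) h
  rcases hs with rfl | ⟨τ, α, y, hτ, ht, hy, rfl⟩
  · exact absurd hr (not_le.2 hsr)
  · exact ⟨τ, α, y, hτ, ht, hy, hsr⟩

/-- Prepend the segment from `x` to `x'` to a nearly optimal trajectory from `x'`. The discounted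
cost then increases by at most the travel time of the segment. -/
lemma value_le_value_add {P : Problem d} (hP : P.Regular) {c : ℝ} (hc : 0 < c)
    (hcf : ∀ x ∈ closure P.Ω, ∀ a ∈ Metric.sphere (0 : Pt d) 1, c ≤ P.f x a) {σ : ℝ}
    (hσ : σ * σ = 1) (K : Set (Pt d)) {x x' : Pt d} (hseg : segment ℝ x x' ⊆ P.Ω) :
    P.value σ K x ≤ P.value σ K x' + c⁻¹ * ‖x' - x‖ := by
  rcases eq_or_ne x x' with rfl | hne
  · simp
  obtain ⟨τ₁, α₁, y₁, h0, h1, h2, h3⟩ := hP.exists_segment_trajectory hc hcf hσ hne hseg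
  rw [div_eq_inv_mul] at h1
  refine le_of_forall_pos_le_add fun ε hε => ?_
  rcases lt_or_ge (P.value σ K x' + ε) 1 with hlt | hge
  · obtain ⟨τ, α, y, hτ, ht, hy, hr⟩ :=
      exists_trajectory_of_value_lt (lt_add_of_pos_right (P.value σ K x') hε) hlt.le
    rw [← h3] at ht
    obtain ⟨α', y', h', hy'⟩ := h2.concat hP ht h0 hτ
    have hv := value_le (add_nonneg h0 hτ) h' (hy' ▸ hy)
    have e1 : Real.exp (-(τ₁ + τ)) = Real.exp (-τ₁) * Real.exp (-τ) := by
      rw [neg_add, Real.exp_add]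
    have e2 : 1 - τ₁ ≤ Real.exp (-τ₁) := Real.one_sub_le_exp_neg τ₁
    have e3 : Real.exp (-τ) ≤ 1 := Real.exp_le_one_iff.2 (by linarith)
    have e4 := Real.exp_pos (-τ)
    rw [e1] at hv
    nlinarith
  · have := value_le_one P σ K x
    linarith [h0.trans h1, value_nonneg P σ K x']

lemma vd_mem (P : Problem d) (x : Pt d) : P.vd x ∈ Icc (0 : ℝ) 1 :=
  ⟨value_nonneg _ _ _ _, value_le_one _ _ _ _⟩

lemma vs_mem (P : Problem d) (x : Pt d) : P.vs x ∈ Icc (0 : ℝ) 1 :=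
  ⟨value_nonneg _ _ _ _, value_le_one _ _ _ _⟩

lemma combine_nonneg {a b : ℝ} (ha : a ∈ Icc (0 : ℝ) 1) (hb : b ∈ Icc (0 : ℝ) 1) :
    0 ≤ combine a b := by
  unfold combine
  nlinarith [ha.1, ha.2, hb.1, hb.2]

/-- `combine` is monotone and `1`-Lipschitz in each variable. -/
lemma combine_le_add {a b a' b' α β : ℝ} (hb : b ∈ Icc (0 : ℝ) 1)
    (ha' : a' ∈ Icc (0 : ℝ) 1) (hα : 0 ≤ α) (hβ : 0 ≤ β) (h1 : a' ≤ a + α) (h2 : b' ≤ b + β) :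
    combine a' b' ≤ combine a b + (α + β) := by
  have e1 : (a' - a) * (1 - b) ≤ α := by nlinarith [hb.1, hb.2]
  have e2 : (b' - b) * (1 - a') ≤ β := by nlinarith [ha'.1, ha'.2]
  unfold combine
  nlinarith

lemma Fv_nonneg (P : Problem d) (x : Pt d) : 0 ≤ P.Fv x :=
  combine_nonneg (vs_mem P x) (vd_mem P x)

lemma bddBelow_Fv (P : Problem d) (A : Set (Pt d)) : BddBelow (P.Fv '' A) :=
  ⟨0, by rintro _ ⟨x, -, rfl⟩; exact Fv_nonneg P x⟩

/-- Along a trajectory from the source to the destination, `F_v` is at most the cost. -/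
lemma Fv_le_of_trajectory {P : Problem d} (hP : P.Regular) {τ : ℝ} {x : Pt d} {α y : ℝ → Pt d}
    (h : P.IsTrajectory 1 τ x α y) (hx : x ∈ P.Ksrc) (hy : y τ ∈ P.Kdst) {t : ℝ}
    (ht : t ∈ Icc 0 τ) : P.Fv (y t) ≤ 1 - Real.exp (-τ) := by
  have h0 := h.init (ht.1.trans ht.2)
  obtain ⟨α₁, y₁, h₁, hy₁⟩ := h.tail hP ht.1
  have hd : P.vd (y t) ≤ 1 - Real.exp (-(τ - t)) :=
    value_le (by linarith [ht.2]) h₁ (hy₁ ▸ hy)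
  have hs : P.vs (y t) ≤ 1 - Real.exp (-t) :=
    value_le ht.1 ((h.restrict ht.2).reverse hP) (by simpa [h0] using hx)
  have e1 : Real.exp (-τ) = Real.exp (-t) * Real.exp (-(τ - t)) := by
    rw [← Real.exp_add]; congr 1; ring
  have e2 := Real.exp_pos (-t)
  have e3 := Real.exp_pos (-(τ - t))
  -- The right-hand side is `1 - F_v (y t)`.
  have e4 : Real.exp (-t) * Real.exp (-(τ - t)) ≤ (1 - P.vs (y t)) * (1 - P.vd (y t)) :=
    mul_le_mul (by linarith) (by linarith) e3.le (by linarith)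
  unfold Problem.Fv combine
  rw [e1]
  linarith

lemma vstar_le {P : Problem d} {x : Pt d} (hx : x ∈ P.Ksrc) : P.vstar ≤ P.vd x :=
  csInf_le ⟨0, by rintro _ ⟨x, -, rfl⟩; exact (vd_mem P x).1⟩ (mem_image_of_mem _ hx)

lemma vstar_le_one (P : Problem d) : P.vstar ≤ 1 := by
  rcases P.Ksrc.eq_empty_or_nonempty with h | ⟨x, hx⟩
  · simp [Problem.vstar, h]
  · exact (vstar_le hx).trans (vd_mem P x).2

/-- Reversing a nearly optimal reverse trajectory from `x` to the source and continuing with one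
from `x` to the destination gives an admissible trajectory from a point of `Ksrc`, whose cost is the
`combine` of the two costs. -/
lemma vstar_le_Fv {P : Problem d} (hP : P.Regular) (x : Pt d) : P.vstar ≤ P.Fv x := by
  -- A quarter of the gap: the errors `ε` in the two values raise `combine` by at most `2 * ε`, half
  -- of the gap.
  by_contra! hlt
  set ε := (P.vstar - P.Fv x) / 4 with hε
  have hε0 : 0 < ε := by linarith
  have hs0 := vs_mem P x
  have hd0 := vd_mem P x
  have h1 := vstar_le_one P
  have hF : P.Fv x = P.vs x + P.vd x - P.vs x * P.vd x := rfl
  -- `1 - v_s ≥ (1 - v_s)(1 - v_d) = 1 - F_v ≥ v* - F_v = 4ε`, and likewise for `v_d`; so both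
  -- values are approached by actual trajectories.
  have hs1 : P.vs x + ε ≤ 1 := by
    nlinarith [mul_nonneg hd0.1 (sub_nonneg.2 hs0.2)]
  have hd1 : P.vd x + ε ≤ 1 := by
    nlinarith [mul_nonneg hs0.1 (sub_nonneg.2 hd0.2)]
  obtain ⟨τ₁, α₁, y₁, hτ₁, h₁, hy₁, hr₁⟩ :=
    exists_trajectory_of_value_lt (lt_add_of_pos_right (P.vs x) hε0) hs1
  obtain ⟨τ₂, α₂, y₂, hτ₂, h₂, hy₂, hr₂⟩ :=
    exists_trajectory_of_value_lt (lt_add_of_pos_right (P.vd x) hε0) hd1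
  have h₁' := h₁.reverse hP
  rw [neg_neg] at h₁'
  have hend : (fun t => y₁ (τ₁ - t)) τ₁ = x := by simp [h₁.init hτ₁]
  rw [← hend] at h₂
  obtain ⟨α, y, h, hy⟩ := h₁'.concat hP h₂ hτ₁ hτ₂
  have hv : P.vd (y₁ τ₁) ≤ 1 - Real.exp (-(τ₁ + τ₂)) :=
    value_le (add_nonneg hτ₁ hτ₂) h (hy ▸ hy₂)
  have hle := (vstar_le hy₁).trans hv
  have hc := combine_le_add (a := P.vs x) (b := P.vd x) (a' := 1 - Real.exp (-τ₁))
    (b' := 1 - Real.exp (-τ₂)) hd0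
    ⟨by linarith [Real.exp_le_one_iff.2 (by linarith : -τ₁ ≤ 0)], by linarith [Real.exp_pos (-τ₁)]⟩
    hε0.le hε0.le hr₁.le hr₂.le
  have e1 : combine (1 - Real.exp (-τ₁)) (1 - Real.exp (-τ₂)) = 1 - Real.exp (-(τ₁ + τ₂)) := by
    rw [neg_add, Real.exp_add]; unfold combine; ring
  rw [e1] at hc
  have e2 : combine (P.vs x) (P.vd x) = P.Fv x := rfl
  linarith

/-! ### Sublevel sets and geodesic points -/

/-- The minimal value `inf_Ω F_v`. -/
noncomputable def Problem.minFv (P : Problem d) : ℝ := sInf (P.Fv '' P.Ω)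

lemma minFv_le (P : Problem d) {x : Pt d} (hx : x ∈ P.Ω) : P.minFv ≤ P.Fv x :=
  csInf_le (bddBelow_Fv P _) (mem_image_of_mem _ hx)

lemma vstar_le_minFv {P : Problem d} (hP : P.Regular) (hne : P.Ω.Nonempty) :
    P.vstar ≤ P.minFv :=
  le_csInf (hne.image _) (by rintro _ ⟨x, -, rfl⟩; exact vstar_le_Fv hP x)

lemma mem_sublevel {P : Problem d} {η : ℝ} {x : Pt d} :
    x ∈ P.sublevel η ↔ x ∈ P.Ω ∧ P.Fv x < P.minFv + η := Iff.rfl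

lemma sublevel_mono {P : Problem d} {η η' : ℝ} (h : η ≤ η') : P.sublevel η ⊆ P.sublevel η' :=
  fun _ hx => ⟨hx.1, hx.2.trans_le (by linarith)⟩

/-- The geodesics are nonempty, so `Ω` is, and `inf_Ω F_v < 1`. -/
lemma minFv_lt_one {P : Problem d} (hP : P.Regular) (hΓ : P.geodesics.Nonempty) :
    P.Ω.Nonempty ∧ P.minFv < 1 := by
  obtain ⟨z, x, hx, -, τ, α, y, hτ, h, hy, -, -⟩ := hΓ
  refine ⟨⟨x, hP.src_subset hx⟩, (minFv_le P (hP.src_subset hx)).trans_lt ?_⟩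
  have := Fv_le_of_trajectory hP h hx hy ⟨le_rfl, hτ⟩
  rw [h.init hτ] at this
  linarith [Real.exp_pos (-τ)]

lemma closure_sublevel_subset {P : Problem d} (hP : P.Regular) {η : ℝ}
    (h : closure (P.nbhd η) ⊆ P.Ω) : closure (P.sublevel η) ⊆ P.Ω := by
  have h1 : P.sublevel η ⊆ P.nbhd η ∪ (P.Ksrc ∪ P.Kdst) := fun x hx => by
    by_cases hK : x ∈ P.Ksrc ∪ P.Kdst
    · exact Or.inr hK
    · exact Or.inl ⟨hx, hK⟩
  refine (closure_mono h1).trans ?_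
  rw [closure_union, (hP.src_compact.isClosed.union hP.dst_compact.isClosed).closure_eq]
  exact union_subset h (union_subset hP.src_subset hP.dst_subset)

/-- The value functions are Lipschitz continuous at short distance of a sublevel set that stays
away from the boundary of `Ω`. -/
structure Problem.LocallyLipschitz (P : Problem d) (A : Set (Pt d)) (ρ L : ℝ) : Prop where
  mem : ∀ x ∈ A, ∀ x', ‖x' - x‖ < ρ → x' ∈ P.Ω
  vs : ∀ x ∈ A, ∀ x', ‖x' - x‖ < ρ → P.vs x' ≤ P.vs x + L * ‖x' - x‖
  vd : ∀ x ∈ A, ∀ x', ‖x' - x‖ < ρ → P.vd x' ≤ P.vd x + L * ‖x' - x‖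

lemma Problem.LocallyLipschitz.Fv {P : Problem d} {A : Set (Pt d)} {ρ L : ℝ}
    (h : P.LocallyLipschitz A ρ L) (hL : 0 ≤ L) {x x' : Pt d} (hx : x ∈ A) (hx' : ‖x' - x‖ < ρ) :
    P.Fv x' ≤ P.Fv x + 2 * L * ‖x' - x‖ := by
  have h0 : 0 ≤ L * ‖x' - x‖ := by positivity
  have := combine_le_add (vd_mem P x) (vs_mem P x') h0 h0 (h.vs x hx x' hx') (h.vd x hx x' hx')
  unfold Problem.Fv
  linarith

/-- The constant `L` is the inverse of the smallest speed and does not depend on `A`; only the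
radius does. Balls of that radius around points of `A` lie in `Ω` and are convex, so they contain
the segments to be travelled. -/
lemma Problem.Regular.exists_locallyLipschitz {P : Problem d} (hP : P.Regular) :
    ∃ L : ℝ, 0 < L ∧ ∀ A : Set (Pt d), closure A ⊆ P.Ω →
      ∃ ρ : ℝ, 0 < ρ ∧ P.LocallyLipschitz A ρ L := by
  obtain ⟨c, hc, hcf⟩ := hP.exists_speed_ge
  refine ⟨c⁻¹, inv_pos.2 hc, fun A hA => ?_⟩
  have hcomp : IsCompact (closure A) :=
    (hP.isBounded.subset (subset_closure.trans hA)).isCompact_closure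
  obtain ⟨ρ, hρ, hsub⟩ := hcomp.exists_thickening_subset_open hP.isOpen hA
  have hball : ∀ x ∈ A, Metric.ball x ρ ⊆ P.Ω := fun x hx =>
    (Metric.ball_subset_thickening (subset_closure hx) ρ).trans hsub
  have hseg : ∀ x ∈ A, ∀ x', ‖x' - x‖ < ρ → segment ℝ x' x ⊆ P.Ω := fun x hx x' hx' =>
    ((convex_ball x ρ).segment_subset (by simpa [dist_eq_norm] using hx')
      (Metric.mem_ball_self hρ)).trans (hball x hx)
  refine ⟨ρ, hρ, fun x hx x' hx' => hball x hx (by simpa [dist_eq_norm] using hx'),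
    fun x hx x' hx' => ?_, fun x hx x' hx' => ?_⟩
  · rw [norm_sub_rev]
    exact value_le_value_add hP hc hcf (by norm_num) _ (hseg x hx x' hx')
  · rw [norm_sub_rev]
    exact value_le_value_add hP hc hcf (by norm_num) _ (hseg x hx x' hx')

lemma continuousOn_Fv {P : Problem d} (hP : P.Regular) : ContinuousOn P.Fv P.Ω := by
  obtain ⟨c, hc, hcf⟩ := hP.exists_speed_ge
  have key : ∀ (σ : ℝ) (K : Set (Pt d)), σ * σ = 1 → ContinuousOn (P.value σ K) P.Ω := by
    intro σ K hσ x hx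
    refine ContinuousAt.continuousWithinAt ?_
    obtain ⟨ρ, hρ, hball⟩ := Metric.isOpen_iff.1 hP.isOpen x hx
    refine continuousAt_of_locally_lipschitz hρ c⁻¹ fun x' hx' => ?_
    have hseg : segment ℝ x' x ⊆ P.Ω :=
      ((convex_ball x ρ).segment_subset hx' (Metric.mem_ball_self hρ)).trans hball
    have h1 := value_le_value_add hP hc hcf hσ K hseg
    have h2 := value_le_value_add hP hc hcf hσ K (segment_symm ℝ x' x ▸ hseg)
    rw [norm_sub_rev] at h1
    rw [dist_eq_norm, Real.norm_eq_abs, dist_eq_norm, abs_le]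
    constructor <;> linarith
  have hs : ContinuousOn P.vs P.Ω := key (-1) P.Ksrc (by norm_num)
  have hd : ContinuousOn P.vd P.Ω := key 1 P.Kdst (by norm_num)
  exact (hs.add hd).sub (hs.mul hd)

lemma isOpen_sublevel {P : Problem d} (hP : P.Regular) (η : ℝ) : IsOpen (P.sublevel η) :=
  (continuousOn_Fv hP).isOpen_inter_preimage hP.isOpen isOpen_Iio

lemma closure_sublevel_subset_sublevel {P : Problem d} (hP : P.Regular) {η η' : ℝ} (h : η < η')
    (hη : closure (P.sublevel η) ⊆ P.Ω) : closure (P.sublevel η) ⊆ P.sublevel η' := by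
  intro x hx
  refine ⟨hη hx, ?_⟩
  have h1 : ContinuousWithinAt P.Fv (P.sublevel η) x :=
    ((continuousOn_Fv hP) x (hη hx)).mono fun _ hz => hz.1
  have h2 := h1.closure_le hx continuousWithinAt_const (g := fun _ => P.minFv + η)
    fun z hz => (mem_sublevel.1 hz).2.le
  exact h2.trans_lt (by change P.minFv + η < P.minFv + η'; linarith)

/-- The `δ`-geodesic points lie in the sublevel sets of `F_v`. -/
lemma deltaGeodesics_subset {P : Problem d} (hP : P.Regular) {δ η : ℝ}
    (hδ : δ < η) (hη : closure (P.sublevel η) ⊆ P.Ω) :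
    P.deltaGeodesics δ ⊆ P.sublevel η := by
  rintro z ⟨δ', hδ', x, hxf, hxv, τ, α, y, hτ, h, hyK, hcost, t, ht, rfl⟩
  have hx : x ∈ P.Ksrc := hP.src_compact.isClosed.frontier_subset hxf
  have hm : P.vstar ≤ P.minFv := vstar_le_minFv hP ⟨x, hP.src_subset hx⟩
  have hF : ∀ s ∈ Icc 0 τ, P.Fv (y s) < P.minFv + η := fun s hs => by
    have := Fv_le_of_trajectory hP h hx hyK hs
    linarith
  refine ⟨?_, hF t ht⟩
  by_contra hbad
  -- A trajectory may a priori touch the boundary of `Ω`. At the first time outside `Ω` it would be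
  -- a limit of points of the sublevel set, whose closure lies in `Ω`.
  set B : Set ℝ := Icc 0 τ ∩ y ⁻¹' P.Ωᶜ with hB
  have hBc : IsCompact B :=
    (isCompact_Icc : IsCompact (Icc 0 τ)).of_isClosed_subset
      (h.cont.preimage_isClosed_of_isClosed isClosed_Icc hP.isOpen.isClosed_compl)
      inter_subset_left
  obtain ⟨s, hs, hmin⟩ := hBc.exists_isLeast ⟨t, ht, hbad⟩
  have hs0 : 0 < s := by
    rcases hs.1.1.eq_or_lt with h0 | h0
    · refine absurd ?_ hs.2
      rw [← h0]
      simpa [h.init hτ] using hP.src_subset hx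
    · exact h0
  refine hs.2 (hη ?_)
  have hcl : s ∈ closure (Ico 0 s) := by rw [closure_Ico hs0.ne]; exact ⟨hs0.le, le_rfl⟩
  have hcont : ContinuousWithinAt y (Ico 0 s) s :=
    (h.cont s hs.1).mono fun r hr => ⟨hr.1, hr.2.le.trans hs.1.2⟩
  refine closure_mono ?_ (hcont.mem_closure_image hcl)
  rintro _ ⟨r, hr, rfl⟩
  have hrI : r ∈ Icc 0 τ := ⟨hr.1, hr.2.le.trans hs.1.2⟩
  refine ⟨?_, hF r hrI⟩
  by_contra hrB
  exact absurd (hmin ⟨hrI, hrB⟩) (not_le.2 hr.2)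

/-- The sublevel set is open, so its points in the closure of the complement of the targets are
limits of points of the sublevel set outside the targets. -/
lemma deltaGeodesics_diff_subset {P : Problem d} (hP : P.Regular) {δ η : ℝ}
    (hδ : δ < η) (hη : closure (P.sublevel η) ⊆ P.Ω) :
    P.deltaGeodesics δ \ interior (P.Ksrc ∪ P.Kdst) ⊆ closure (P.nbhd η) := by
  rintro z ⟨hz, hzK⟩
  rw [← mem_compl_iff, ← closure_compl] at hzK
  exact (isOpen_sublevel hP η).inter_closure ⟨deltaGeodesics_subset hP hδ hη hz, hzK⟩

end FastMarching

namespace FastMarching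

variable {d : ℕ}

/-! ### Lattices and interpolation -/

lemma norm_sub_le_of_abs_le {x y : Pt d} {r : ℝ} (hr : 0 ≤ r) (h : ∀ i, |x i - y i| ≤ r) :
    ‖x - y‖ ≤ √d * r := by
  rw [EuclideanSpace.norm_eq]
  refine Real.sqrt_le_iff.2 ⟨by positivity, ?_⟩
  rw [mul_pow, Real.sq_sqrt (Nat.cast_nonneg d)]
  calc ∑ i, ‖(x - y) i‖ ^ 2 ≤ ∑ _i : Fin d, r ^ 2 :=
        Finset.sum_le_sum fun i _ => pow_le_pow_left₀ (norm_nonneg _) (h i) 2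
    _ = d * r ^ 2 := by simp

lemma finite_lattice_inter {Ω : Set (Pt d)} (hΩ : Bornology.IsBounded Ω) (o : Pt d) {H : ℝ}
    (hH : 0 < H) : (lattice o H ∩ Ω).Finite := by
  obtain ⟨R, hR⟩ := hΩ.exists_norm_le
  have hfin : {k : Fin d → ℤ | ∀ i, k i ∈ Icc ⌊(-R - o i) / H⌋ ⌈(R - o i) / H⌉}.Finite :=
    Set.Finite.pi' fun i => Set.finite_Icc _ _
  refine (hfin.image fun k => (WithLp.toLp 2 fun i => o i + H * (k i : ℝ) : Pt d)).subset ?_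
  rintro x ⟨⟨k, hk⟩, hx⟩
  refine ⟨k, fun i => ?_, ?_⟩
  · have hxi : |x i| ≤ R := (PiLp.norm_apply_le x i).trans (hR x hx)
    have hki : (k i : ℝ) = (x i - o i) / H := by rw [hk i]; field_simp; ring
    obtain ⟨h1, h2⟩ := abs_le.1 hxi
    constructor
    · have : ((⌊(-R - o i) / H⌋ : ℤ) : ℝ) ≤ k i := by
        rw [hki]; exact (Int.floor_le _).trans (by gcongr)
      exact_mod_cast this
    · have : (k i : ℝ) ≤ (⌈(R - o i) / H⌉ : ℤ) := by
        rw [hki]; exact le_trans (by gcongr) (Int.le_ceil _)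
      exact_mod_cast this
  · ext i
    simp [hk i]

lemma exists_lattice_near (o : Pt d) {H : ℝ} (hH : 0 < H) (x : Pt d) :
    ∃ z ∈ lattice o H, ∀ i, |x i - z i| ≤ H / 2 := by
  refine ⟨WithLp.toLp 2 fun i => o i + H * (round ((x i - o i) / H) : ℝ),
    ⟨fun i => round ((x i - o i) / H), fun i => rfl⟩, fun i => ?_⟩
  have h1 := abs_sub_round ((x i - o i) / H)
  have h2 : x i - (o i + H * (round ((x i - o i) / H) : ℝ)) =
      H * ((x i - o i) / H - round ((x i - o i) / H)) := by field_simp; ring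
  change |x i - (o i + H * (round ((x i - o i) / H) : ℝ))| ≤ H / 2
  rw [h2, abs_mul, abs_of_pos hH]
  nlinarith

lemma IsLinearInterpolation.mem_lattice {o : Pt d} {H : ℝ} {w : Pt d → (Pt d →₀ ℝ)}
    (hw : IsLinearInterpolation o H w) {x y : Pt d} (hy : y ∈ (w x).support) :
    y ∈ lattice o H ∧ ∀ i, |y i - x i| ≤ H := by
  classical
  obtain ⟨⟨k, hk, hv⟩, -⟩ := hw x
  refine ⟨⟨fun i => if y i = o i + H * (k i : ℝ) then k i else k i + 1, fun i => ?_⟩, fun i => ?_⟩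
  · by_cases h : y i = o i + H * (k i : ℝ)
    · simp [h]
    · have := (hv y hy i).resolve_left h
      simp [this]
  · obtain ⟨h1, h2⟩ := hk i
    rw [abs_le]
    rcases hv y hy i with h | h <;> rw [h] <;> constructor <;> linarith

lemma IsLinearInterpolation.interpolate_le {o : Pt d} {H : ℝ} {w : Pt d → (Pt d →₀ ℝ)}
    (hw : IsLinearInterpolation o H w) {V : Pt d → unitInterval} {x : Pt d} {b : ℝ}
    (h : ∀ y ∈ (w x).support, (V y : ℝ) ≤ b) : interpolate w V x ≤ b := by
  obtain ⟨-, h0, h1, -⟩ := hw x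
  calc interpolate w V x ≤ (w x).sum fun _ c => c * b :=
        Finset.sum_le_sum fun y hy => mul_le_mul_of_nonneg_left (h y hy) (h0 y)
    _ = ((w x).sum fun _ c => c) * b := by rw [Finsupp.sum, Finsupp.sum, Finset.sum_mul]
    _ = b := by rw [h1, one_mul]

lemma IsLinearInterpolation.interpolate_mem {o : Pt d} {H : ℝ} {w : Pt d → (Pt d →₀ ℝ)}
    (hw : IsLinearInterpolation o H w) (V : Pt d → unitInterval) (x : Pt d) :
    interpolate w V x ∈ Icc (0 : ℝ) 1 :=
  ⟨Finset.sum_nonneg fun y _ => mul_nonneg ((hw x).2.1 y) (V y).2.1,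
    hw.interpolate_le fun y _ => (V y).2.2⟩

/-! ### One level of the method -/

variable {S : Scheme d} {P : Problem d} {Cs Cd CO γ : ℝ}

lemma finite_grid (hP : P.Regular) (hS : S.Lawful P) {H : ℝ} (hH : H ∈ S.steps) :
    (S.grid P H).Finite :=
  finite_lattice_inter hP.isBounded _ (hS.steps_pos H hH)

/-- The grid `G` of mesh step `H` contains the nodes of the sublevel set of height `ζ`. -/
structure Scheme.Covers (S : Scheme d) (P : Problem d) (H ζ : ℝ) (G : Set (Pt d)) : Prop where
  step : H ∈ S.steps
  subset : G ⊆ S.grid P H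
  cover : S.grid P H ∩ P.sublevel ζ ⊆ G

lemma Vs_anti (hP : P.Regular) (hS : S.Lawful P) {H : ℝ} (hH : H ∈ S.steps) {G G' : Set (Pt d)}
    (h : G ⊆ G') (hG' : G' ⊆ S.grid P H) (x : Pt d) : S.Vs P H G' x ≤ S.Vs P H G x :=
  march_anti (hS.src H hH) h ((finite_grid hP hS hH).subset hG') x

lemma Vd_anti (hP : P.Regular) (hS : S.Lawful P) {H : ℝ} (hH : H ∈ S.steps) {G G' : Set (Pt d)}
    (h : G ⊆ G') (hG' : G' ⊆ S.grid P H) (x : Pt d) : S.Vd P H G' x ≤ S.Vd P H G x :=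
  march_anti (hS.dst H hH) h ((finite_grid hP hS hH).subset hG') x

lemma Vs_mem (H : ℝ) (G : Set (Pt d)) (x : Pt d) : S.Vs P H G x ∈ Icc (0 : ℝ) 1 :=
  ((S.marchS P H G).val x).2

lemma Vd_mem (H : ℝ) (G : Set (Pt d)) (x : Pt d) : S.Vd P H G x ∈ Icc (0 : ℝ) 1 :=
  ((S.marchD P H G).val x).2

lemma Scheme.Covers.lower (hP : P.Regular) (hS : S.Lawful P) (hErr : S.ErrorBound P Cs Cd CO γ)
    {H ζ : ℝ} {G : Set (Pt d)} (hG : S.Covers P H ζ G) {x : Pt d} (hx : x ∈ S.grid P H) :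
    P.vs x ≤ S.Vs P H G x + Cs * H ^ γ ∧ P.vd x ≤ S.Vd P H G x + Cd * H ^ γ := by
  obtain ⟨h1, h2⟩ := hErr.lower H hG.step x hx
  have h3 := Vs_anti hP hS hG.step hG.subset le_rfl x
  have h4 := Vd_anti hP hS hG.step hG.subset le_rfl x
  constructor <;> linarith

/-- The error bound is applied with `Ω'` the open set `S_ζ`, and `G` contains all its nodes. The gap
`η < ζ` provides `closure S_η ⊆ S_ζ`. -/
lemma Scheme.Covers.upper (hP : P.Regular) (hS : S.Lawful P) (hErr : S.ErrorBound P Cs Cd CO γ)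
    {H ζ η : ℝ} {G : Set (Pt d)} (hG : S.Covers P H ζ G) (hζ : closure (P.sublevel ζ) ⊆ P.Ω)
    (hη : 0 < η) (hηζ : η < ζ) (hCO : CO * H ^ γ ≤ η) {x : Pt d} (hx : x ∈ S.grid P H)
    (hxη : x ∈ P.sublevel (η / 2)) :
    S.Vs P H G x ≤ P.vs x + Cs * H ^ γ ∧ S.Vd P H G x ≤ P.vd x + Cd * H ^ γ := by
  have hcl : closure (P.sublevel η) ⊆ P.sublevel ζ :=
    closure_sublevel_subset_sublevel hP hηζ
      ((closure_mono (sublevel_mono hηζ.le)).trans hζ)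
  obtain ⟨h1, h2⟩ := hErr.upper (P.sublevel ζ) (isOpen_sublevel hP ζ) (fun _ h => h.1) η hη H
    hG.step hcl hCO x ⟨hx, subset_closure hxη⟩
  have h3 := Vs_anti hP hS hG.step hG.cover hG.subset x
  have h4 := Vd_anti hP hS hG.step hG.cover hG.subset x
  constructor <;> linarith

lemma Scheme.Covers.minFv_le (hP : P.Regular) (hS : S.Lawful P)
    (hErr : S.ErrorBound P Cs Cd CO γ) (hCs : 0 < Cs) (hCd : 0 < Cd)
    {H ζ : ℝ} {G : Set (Pt d)} (hG : S.Covers P H ζ G) {x : Pt d} (hx : x ∈ G) :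
    P.minFv ≤ S.FV P H G x + (Cs + Cd) * H ^ γ := by
  have hxg := hG.subset hx
  obtain ⟨h1, h2⟩ := hG.lower hP hS hErr hxg
  have hH := Real.rpow_pos_of_pos (hS.steps_pos H hG.step) γ
  have h3 := combine_le_add (Vd_mem H G x) (vs_mem P x) (mul_pos hCs hH).le
    (mul_pos hCd hH).le h1 h2
  have h4 := FastMarching.minFv_le P hxg.2
  unfold Problem.Fv at h4
  unfold Scheme.FV
  linarith

/-- The smallness conditions at a level of mesh step `H`, for the parameter `η`: the grid covers a
much larger sublevel set, and `η` dominates the errors of discretization and interpolation. -/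
structure Problem.Admissible (P : Problem d) (Cs Cd CO γ L ρ ε H η ζ : ℝ) : Prop where
  eta_pos : 0 < η
  zeta : 8 * η ≤ ζ
  closure_subset : closure (P.sublevel ζ) ⊆ P.Ω
  lip : P.LocallyLipschitz (P.sublevel ζ) ρ L
  mesh : √d * H < ρ
  CO_le : CO * H ^ γ ≤ η
  error : 2 * ((Cs + Cd) * H ^ γ) + 2 * (L * (√d * H)) ≤ ε * η
  eta_le : η ≤ 1 - P.minFv

section Level

variable {L ρ ε H η ζ : ℝ} {G : Set (Pt d)}

/-- Nodes near the sublevel set of height `(1 - ε) η`: they belong to the grid, and the computed values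
there are close to the exact values at the nearby point. -/
lemma Scheme.Covers.near (hP : P.Regular) (hS : S.Lawful P)
    (hErr : S.ErrorBound P Cs Cd CO γ) (hCs : 0 < Cs) (hCd : 0 < Cd) (hL : 0 < L)
    (hA : P.Admissible Cs Cd CO γ L ρ ε H η ζ) (hG : S.Covers P H ζ G) {x z : Pt d}
    (hx : x ∈ P.sublevel ((1 - ε) * η)) (hε : 0 ≤ ε) (hz : z ∈ lattice (S.origin H) H)
    (hzx : ∀ i, |z i - x i| ≤ H) :
    z ∈ G ∧ S.Vs P H G z ≤ P.vs x + (L * (√d * H) + Cs * H ^ γ) ∧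
      S.Vd P H G z ≤ P.vd x + (L * (√d * H) + Cd * H ^ γ) := by
  have hη := hA.eta_pos
  have hH := hS.steps_pos H hG.step
  have hHγ := Real.rpow_pos_of_pos hH γ
  have hζ := hA.zeta
  have hdist : ‖z - x‖ ≤ √d * H := norm_sub_le_of_abs_le hH.le hzx
  have hdρ := hdist.trans_lt hA.mesh
  have hεη : 0 ≤ ε * η := mul_nonneg hε hη.le
  have hxζ : x ∈ P.sublevel ζ := sublevel_mono (by linarith) hx
  have hzΩ := hA.lip.mem x hxζ z hdρ
  have hF := hA.lip.Fv hL.le hxζ hdρ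
  have hLd : L * ‖z - x‖ ≤ L * (√d * H) := mul_le_mul_of_nonneg_left hdist hL.le
  have herr := hA.error
  have hC : 0 < (Cs + Cd) * H ^ γ := mul_pos (add_pos hCs hCd) hHγ
  -- The upper bound is used with parameter `ζ / 2 < ζ`, hence on `S_{ζ/4}`; as `ζ ≥ 8 η`, this
  -- leaves ample room for the displacement from `x` to `z`.
  have hzs : z ∈ P.sublevel (ζ / 2 / 2) := by
    refine ⟨hzΩ, ?_⟩
    have := (mem_sublevel.1 hx).2
    change P.Fv z < P.minFv + ζ / 2 / 2
    linarith
  have hzg : z ∈ S.grid P H := ⟨hz, hzΩ⟩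
  obtain ⟨h1, h2⟩ := hG.upper hP hS hErr hA.closure_subset (by linarith) (by linarith)
    (hA.CO_le.trans (by linarith)) hzg hzs
  have h3 := hA.lip.vs x hxζ z hdρ
  have h4 := hA.lip.vd x hxζ z hdρ
  exact ⟨hG.cover ⟨hzg, sublevel_mono (by linarith) hzs⟩, by linarith, by linarith⟩

/-- A combination of approximate values near the sublevel set of height `(1 - ε) η` is below the
activity threshold. -/
lemma Scheme.Covers.combine_lt (hP : P.Regular) (hS : S.Lawful P)
    (hErr : S.ErrorBound P Cs Cd CO γ) (hCs : 0 < Cs) (hCd : 0 < Cd) (hL : 0 < L)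
    (hA : P.Admissible Cs Cd CO γ L ρ ε H η ζ) (hG : S.Covers P H ζ G) {x : Pt d}
    (hx : x ∈ P.sublevel ((1 - ε) * η)) {a b : ℝ} (ha : a ∈ Icc (0 : ℝ) 1)
    (has : a ≤ P.vs x + (L * (√d * H) + Cs * H ^ γ))
    (hbd : b ≤ P.vd x + (L * (√d * H) + Cd * H ^ γ)) :
    combine a b < P.minFv + η ∧ ∀ y ∈ G, combine a b < S.FV P H G y + η := by
  have hH := hS.steps_pos H hG.step
  have hHγ := Real.rpow_pos_of_pos hH γ
  have hLH : 0 ≤ L * (√d * H) := by positivity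
  have h1 := combine_le_add (vd_mem P x) ha (by positivity) (by positivity) has hbd
  have hx2 : combine (P.vs x) (P.vd x) < P.minFv + (1 - ε) * η := (mem_sublevel.1 hx).2
  have herr := hA.error
  have hC : 0 < (Cs + Cd) * H ^ γ := mul_pos (add_pos hCs hCd) hHγ
  refine ⟨by linarith, fun y hy => ?_⟩
  -- The discretization error counts twice, once above the exact values at `x` and once below them
  -- at `y`; hence the factor in `Problem.Admissible.error`.
  have := hG.minFv_le hP hS hErr hCs hCd hy
  linarith

lemma Scheme.Covers.interpolate_lt (hP : P.Regular) (hS : S.Lawful P)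
    (hErr : S.ErrorBound P Cs Cd CO γ) (hCs : 0 < Cs) (hCd : 0 < Cd) (hL : 0 < L)
    (hA : P.Admissible Cs Cd CO γ L ρ ε H η ζ) (hG : S.Covers P H ζ G) {x : Pt d}
    (hx : x ∈ P.sublevel ((1 - ε) * η)) (hε : 0 ≤ ε) {y : Pt d} (hy : y ∈ G) :
    combine (interpolate (S.weight H) (S.marchS P H G).val x)
        (interpolate (S.weight H) (S.marchD P H G).val x) < S.FV P H G y + η := by
  have hI := hS.interp H hG.step
  have hnear := fun z hz => hG.near hP hS hErr hCs hCd hL hA hx hε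
    (hI.mem_lattice (x := x) (y := z) hz).1 (hI.mem_lattice hz).2
  exact (hG.combine_lt hP hS hErr hCs hCd hL hA hx (hI.interpolate_mem _ x)
    (hI.interpolate_le fun z hz => (hnear z hz).2.1)
    (hI.interpolate_le fun z hz => (hnear z hz).2.2)).2 y hy

lemma lt_one_of_combine_lt_one {a b : ℝ} (ha : a ∈ Icc (0 : ℝ) 1) (hb : b ∈ Icc (0 : ℝ) 1)
    (h : combine a b < 1) : a < 1 ∧ b < 1 := by
  unfold combine at h
  constructor
  · refine lt_of_le_of_ne ha.2 ?_
    rintro rfl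
    linarith
  · refine lt_of_le_of_ne hb.2 ?_
    rintro rfl
    linarith

/-- The fine grid contains the fine nodes of the sublevel set of height `(1 - ε) η`. -/
lemma Scheme.Covers.fine (hP : P.Regular) (hS : S.Lawful P)
    (hErr : S.ErrorBound P Cs Cd CO γ) (hCs : 0 < Cs) (hCd : 0 < Cd) (hL : 0 < L)
    (hA : P.Admissible Cs Cd CO γ L ρ ε H η ζ) (hG : S.Covers P H ζ G) (hε : 0 ≤ ε) {h : ℝ}
    (hh : h ∈ S.steps) :
    S.Covers P h ((1 - ε) * η) (S.fine P H h (S.active P H η G)) := by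
  refine ⟨hh, fun _ hx => hx.1, fun x ⟨hxg, hxs⟩ => ⟨hxg, ?_⟩⟩
  have hH := hS.steps_pos H hG.step
  obtain ⟨z, hz, hzx⟩ := exists_lattice_near (S.origin H) hH x
  have hGfin := (finite_grid hP hS hG.step).subset hG.subset
  obtain ⟨hzG, h1, h2⟩ := hG.near hP hS hErr hCs hCd hL hA hxs hε hz fun i => by
    rw [abs_sub_comm]; linarith [hzx i]
  obtain ⟨h3, h4⟩ := hG.combine_lt hP hS hErr hCs hCd hL hA hxs (Vs_mem H G z) h1 h2
  -- Since `η ≤ 1 - inf F_v`, both computed values are below `1`, which forces acceptance in both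
  -- directions.
  obtain ⟨h5, h6⟩ := lt_one_of_combine_lt_one (Vs_mem H G z) (Vd_mem H G z)
    (h3.trans_le (by linarith [hA.eta_le]))
  refine ⟨z, ⟨hzG, march_mem_accepted (hS.src H hG.step) hGfin h5,
    march_mem_accepted (hS.dst H hG.step) hGfin h6, fun y hy => (h4 y hy).le⟩, fun i => ?_⟩
  refine (hzx i).trans ?_
  -- The fine-grid radius `max (H - h) h` is always at least `H / 2`, the distance to a nearest
  -- coarse node.
  rcases le_total h (H / 2) with hle | hle
  · exact le_max_of_le_left (by linarith)
  · exact le_max_of_le_right hle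

end Level

end FastMarching

namespace FastMarching

variable {d : ℕ} {S : Scheme d} {P : Problem d} {Cs Cd CO γ : ℝ}

/-! ### All levels -/

lemma Problem.LocallyLipschitz.mono {A B : Set (Pt d)} {ρ L : ℝ} (h : P.LocallyLipschitz B ρ L)
    (hAB : A ⊆ B) : P.LocallyLipschitz A ρ L :=
  ⟨fun x hx => h.mem x (hAB hx), fun x hx => h.vs x (hAB hx), fun x hx => h.vd x (hAB hx)⟩

lemma Scheme.IsMeshSequence.le {κ H₀ : ℝ} {N : ℕ} {H : ℕ → ℝ} (h : S.IsMeshSequence κ H₀ N H)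
    {l : ℕ} (hl : 1 ≤ l) (hlN : l ≤ N) : H l ≤ H₀ := by
  induction l, hl using Nat.le_induction with
  | base => exact h.first_le
  | succ l hl ih => exact (h.anti l hl (by omega)).trans (ih (by omega))

/-- The constants of the multi-level method. -/
lemma exists_constants (hP : P.Regular) (hΓ : P.geodesics.Nonempty)
    (hO : ∃ ηbar : ℝ, 0 < ηbar ∧ closure (P.nbhd ηbar) ⊆ P.Ω)
    (hCs : 0 < Cs) (hCd : 0 < Cd) (hCO : 0 < CO) (hγ : 0 < γ) (hγ1 : γ ≤ 1)
    {ε : ℝ} (hε : 0 < ε) :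
    ∃ Cη κ H₀ L ρ ζ₀ : ℝ, 0 < Cη ∧ 0 < κ ∧ 0 < H₀ ∧ 0 < L ∧ κ ^ γ = 16 ∧ 2 * CO ≤ Cη ∧
      (∀ H, 0 < H → H ≤ H₀ → 8 * (Cη * H ^ γ) ≤ ζ₀) ∧
      ∀ H ζ, 0 < H → H ≤ H₀ → 8 * (Cη * H ^ γ) ≤ ζ → ζ ≤ ζ₀ →
        P.Admissible Cs Cd CO γ L ρ ε H (Cη * H ^ γ) ζ := by
  obtain ⟨ζ₀, hζ₀, hcl⟩ := hO
  have hcl' := closure_sublevel_subset hP hcl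
  obtain ⟨L, hL, hlip⟩ := hP.exists_locallyLipschitz
  obtain ⟨ρ, hρ, hlip⟩ := hlip _ hcl'
  obtain ⟨-, hm⟩ := minFv_lt_one hP hΓ
  -- The quotient absorbs the errors into `ε * η`, using `H ≤ H ^ γ` for `H ≤ 1`; the term `2 * CO`
  -- meets the threshold of the error bound, also at half of `η`.
  set Cη : ℝ := (2 * (Cs + Cd) + 2 * (L * √d)) / ε + 2 * CO with hCη
  have hfrac : 0 ≤ (2 * (Cs + Cd) + 2 * (L * √d)) / ε := by positivity
  have hCη0 : 0 < Cη := by linarith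
  set m : ℝ := min (ζ₀ / 8) (1 - P.minFv) with hmdef
  have hm0 : 0 < m := lt_min (by linarith) (by linarith)
  have hd : 0 < √(d : ℝ) + 1 := by positivity
  set H₀ : ℝ := min 1 (min (ρ / (√d + 1)) ((m / Cη) ^ γ⁻¹)) with hH₀
  have hH₀pos : 0 < H₀ := by
    refine lt_min one_pos (lt_min (by positivity) (Real.rpow_pos_of_pos (by positivity) _))
  have hsmall : ∀ H, 0 < H → H ≤ H₀ → Cη * H ^ γ ≤ m := by
    intro H hH hHH
    have h1 : H ≤ (m / Cη) ^ γ⁻¹ := hHH.trans ((min_le_right _ _).trans (min_le_right _ _))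
    have h2 := Real.rpow_le_rpow hH.le h1 hγ.le
    rw [Real.rpow_inv_rpow (by positivity) hγ.ne'] at h2
    calc Cη * H ^ γ ≤ Cη * (m / Cη) := mul_le_mul_of_nonneg_left h2 hCη0.le
      _ = m := by field_simp
  refine ⟨Cη, (16 : ℝ) ^ γ⁻¹, H₀, L, ρ, ζ₀, hCη0, by positivity, hH₀pos, hL,
    Real.rpow_inv_rpow (by norm_num) hγ.ne', by linarith, fun H hH hHH => ?_,
    fun H ζ hH hHH h8 hζ => ?_⟩
  · linarith [hsmall H hH hHH, min_le_left (ζ₀ / 8) (1 - P.minFv)]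
  · have hHγ := Real.rpow_pos_of_pos hH γ
    have hH1 : H ≤ 1 := hHH.trans (min_le_left _ _)
    have hHle : H ≤ H ^ γ := by
      simpa using Real.rpow_le_rpow_of_exponent_ge hH hH1 hγ1
    refine ⟨mul_pos hCη0 hHγ, h8, (closure_mono (sublevel_mono hζ)).trans hcl',
      hlip.mono (sublevel_mono hζ), ?_, ?_, ?_, ?_⟩
    · have h1 : H ≤ ρ / (√d + 1) := hHH.trans ((min_le_right _ _).trans (min_le_left _ _))
      rw [le_div_iff₀ hd] at h1
      linarith
    · exact mul_le_mul_of_nonneg_right (by linarith) hHγ.le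
    · have e1 : ε * (Cη * H ^ γ) =
          (2 * (Cs + Cd) + 2 * (L * √d)) * H ^ γ + ε * (2 * CO) * H ^ γ := by
        rw [hCη]; field_simp
      have e2 : L * √d * H ≤ L * √d * H ^ γ := mul_le_mul_of_nonneg_left hHle (by positivity)
      have e3 : 0 ≤ ε * (2 * CO) * H ^ γ := by positivity
      rw [e1]
      linarith
    · exact (hsmall H hH hHH).trans (min_le_right _ _)

/-- Every level grid contains the nodes of a sublevel set that is large compared with `η`. -/
lemma levelGrid_covers (hP : P.Regular) (hS : S.Lawful P)
    (hErr : S.ErrorBound P Cs Cd CO γ) (hCs : 0 < Cs) (hCd : 0 < Cd) (hγ : 0 < γ)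
    {ε Cη κ H₀ L ρ ζ₀ : ℝ} (hε : 0 ≤ ε) (hε' : ε ≤ 1 / 2) (hCη : 0 < Cη) (hκ0 : 0 < κ)
    (hL : 0 < L) (hκ : κ ^ γ = 16)
    (hζ₀ : ∀ H, 0 < H → H ≤ H₀ → 8 * (Cη * H ^ γ) ≤ ζ₀)
    (hA : ∀ H ζ, 0 < H → H ≤ H₀ → 8 * (Cη * H ^ γ) ≤ ζ → ζ ≤ ζ₀ →
        P.Admissible Cs Cd CO γ L ρ ε H (Cη * H ^ γ) ζ)
    {N : ℕ} {H η : ℕ → ℝ} (hH : S.IsMeshSequence κ H₀ N H) (hη : ∀ l, η l = Cη * H l ^ γ)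
    {l : ℕ} (hl : 1 ≤ l) (hlN : l < N) :
    ∃ ζ ≤ ζ₀, P.Admissible Cs Cd CO γ L ρ ε (H l) (η l) ζ ∧
      S.Covers P (H l) ζ (S.levelGrid P H η l) ∧
      S.Covers P (H (l + 1)) ((1 - ε) * η l) (S.levelGrid P H η (l + 1)) := by
  have hpos : ∀ l, 1 ≤ l → l ≤ N → 0 < H l := fun l h1 h2 => hS.steps_pos _ (hH.mem l h1 h2)
  have hnext : ∀ l, 1 ≤ l → l < N → ∀ ζ ≤ ζ₀, 8 * η l ≤ ζ →
      S.Covers P (H l) ζ (S.levelGrid P H η l) →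
      P.Admissible Cs Cd CO γ L ρ ε (H l) (η l) ζ ∧
      S.Covers P (H (l + 1)) ((1 - ε) * η l) (S.levelGrid P H η (l + 1)) := by
    intro l hl hlN ζ hζ h8 hG
    rw [hη] at h8
    have hAd := hA (H l) ζ (hpos l hl hlN.le) (hH.le hl hlN.le) h8 hζ
    rw [← hη] at hAd
    refine ⟨hAd, ?_⟩
    have := hG.fine hP hS hErr hCs hCd hL hAd hε (hH.mem (l + 1) (by omega) hlN)
    -- `levelGrid` unfolds to a fine grid only at indices of the form `k + 2`.
    obtain ⟨k, rfl⟩ : ∃ k, l = k + 1 := ⟨l - 1, by omega⟩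
    exact this
  have key : ∃ ζ ≤ ζ₀, 8 * η l ≤ ζ ∧ S.Covers P (H l) ζ (S.levelGrid P H η l) := by
    induction l, hl using Nat.le_induction with
    | base =>
      refine ⟨ζ₀, le_rfl, ?_, hH.mem 1 le_rfl hlN.le, le_rfl, inter_subset_left⟩
      rw [hη]
      exact hζ₀ _ (hpos 1 le_rfl hlN.le) (hH.le le_rfl hlN.le)
    | succ l hl ih =>
      obtain ⟨ζ, hζ, h8, hG⟩ := ih (by omega)
      obtain ⟨-, hG'⟩ := hnext l hl (by omega) ζ hζ h8 hG
      have h0 := hpos l hl (by omega)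
      have h1 := hpos (l + 1) (by omega) hlN.le
      have hr := Real.rpow_le_rpow hκ0.le (hH.ratio l hl (by omega)) hγ.le
      rw [hκ, Real.div_rpow h0.le h1.le, le_div_iff₀ (Real.rpow_pos_of_pos h1 γ)] at hr
      have hη0 : 0 < η l := by rw [hη]; exact mul_pos hCη (Real.rpow_pos_of_pos h0 γ)
      -- With `ε ≤ 1 / 2` this gives `(1 - ε) * η l ≥ η l / 2 ≥ 8 * η (l + 1)`, so the height
      -- reached at level `l` serves as the next `ζ`.
      have h16 : 16 * η (l + 1) ≤ η l := by
        rw [hη, hη]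
        linarith [mul_le_mul_of_nonneg_left hr hCη.le]
      have h2 : 0 ≤ ε * η l := mul_nonneg hε hη0.le
      have h3 : ε * η l ≤ 1 / 2 * η l := mul_le_mul_of_nonneg_right hε' hη0.le
      exact ⟨(1 - ε) * η l, by linarith, by linarith, hG'⟩
  obtain ⟨ζ, hζ, h8, hG⟩ := key
  obtain ⟨h1, h2⟩ := hnext l hl hlN ζ hζ h8 hG
  exact ⟨ζ, hζ, h1, hG, h2⟩

/-- The lower bound holds at every node of the full grid; the upper one only on `S_{η/2}`, which
contains the `δ`-geodesic points because `δ < η / 2`. -/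
lemma abs_error_le (hP : P.Regular) (hS : S.Lawful P)
    (hErr : S.ErrorBound P Cs Cd CO γ) {H ζ η δ : ℝ} {G : Set (Pt d)} (hG : S.Covers P H ζ G)
    (hζ : closure (P.sublevel ζ) ⊆ P.Ω) (hη : 0 < η) (hηζ : η < ζ) (hCO : CO * H ^ γ ≤ η)
    (hδ : δ < η / 2) {x : Pt d} (hx : x ∈ S.grid P H ∩ P.deltaGeodesics δ) :
    x ∈ G ∧ |S.Vd P H G x - P.vd x| ≤ Cd * H ^ γ ∧ |S.Vs P H G x - P.vs x| ≤ Cs * H ^ γ := by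
  have hxη : x ∈ P.sublevel (η / 2) := deltaGeodesics_subset hP hδ
    ((closure_mono (sublevel_mono (by linarith))).trans hζ) hx.2
  obtain ⟨h1, h2⟩ := hG.lower hP hS hErr hx.1
  obtain ⟨h3, h4⟩ := hG.upper hP hS hErr hζ hη hηζ hCO hx.1 hxη
  refine ⟨hG.cover ⟨hx.1, sublevel_mono (by linarith) hxη⟩, ?_, ?_⟩ <;> rw [abs_le] <;>
    constructor <;> linarith

end FastMarching

/-! ### The main theorem: choice of `ε` in terms of `θ`, and convergence. -/

theorem mainTheorem1 {d : ℕ} (P : FastMarching.Problem d) (hP : P.Regular)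
    (hΓ : P.geodesics.Nonempty)
    (hO : ∃ ηbar : ℝ, 0 < ηbar ∧ closure (P.nbhd ηbar) ⊆ P.Ω)
    (S : FastMarching.Scheme d) (hS : S.Lawful P)
    (Cs Cd CO γ : ℝ) (hCs : 0 < Cs) (hCd : 0 < Cd) (hCO : 0 < CO) (hγ : 0 < γ) (hγ1 : γ ≤ 1)
    (hErr : S.ErrorBound P Cs Cd CO γ)
    (θ : ℝ) (hθ : 0 < θ) (hθ1 : θ < 1) :
    ∃ Cη κ H₀ : ℝ, 0 < Cη ∧ 0 < κ ∧ 0 < H₀ ∧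
      (∀ (N : ℕ) (H η : ℕ → ℝ), S.IsMeshSequence κ H₀ N H → (∀ l, η l = Cη * H l ^ γ) →
        ∀ l, 1 ≤ l → l < N →
          (closure (P.nbhd (η l / 2)) ⊆ closure (S.activeRegion P H η l) ∧
            ∀ δ < η l / 2,
              P.deltaGeodesics δ \ interior (P.Ksrc ∪ P.Kdst) ⊆ closure (P.nbhd (η l / 2))) ∧
          (∀ δ ≤ θ * (η l / 2), ∀ x ∈ S.grid P (H (l + 1)) ∩ P.deltaGeodesics δ,
            x ∈ S.levelGrid P H η (l + 1) ∧
            |S.levelVd P H η (l + 1) x - P.vd x| ≤ Cd * H (l + 1) ^ γ ∧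
            |S.levelVs P H η (l + 1) x - P.vs x| ≤ Cs * H (l + 1) ^ γ)) ∧
      (∀ ε : ℝ, 0 < ε → ∃ h₀ : ℝ, 0 < h₀ ∧
        ∀ (N : ℕ) (H η : ℕ → ℝ), S.IsMeshSequence κ H₀ N H → (∀ l, η l = Cη * H l ^ γ) →
          H N ≤ h₀ →
          ∀ δ ≤ θ * (η (N - 1) / 2), ∀ x ∈ S.grid P (H N) ∩ P.deltaGeodesics δ,
            |S.levelVd P H η N x - P.vd x| ≤ ε) := by
  open FastMarching in
  obtain ⟨Cη, κ, H₀, L, ρ, ζ₀, hCη, hκ0, hH₀, hL, hκ, hCOη, hζ₀, hA⟩ :=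
    -- With this `ε`, `1 - ε = (3 + θ) / 4` exceeds `(1 + θ) / 2`, the factor used below for the
    -- error at level `l + 1`, and also `1 / 2`, the factor in the first property.
    exists_constants hP hΓ hO hCs hCd hCO hγ hγ1 (ε := (1 - θ) / 4) (by linarith)
  have main : ∀ (N : ℕ) (H η : ℕ → ℝ), S.IsMeshSequence κ H₀ N H →
      (∀ l, η l = Cη * H l ^ γ) → ∀ l, 1 ≤ l → l < N →
        (closure (P.nbhd (η l / 2)) ⊆ closure (S.activeRegion P H η l) ∧
          ∀ δ < η l / 2,
            P.deltaGeodesics δ \ interior (P.Ksrc ∪ P.Kdst) ⊆ closure (P.nbhd (η l / 2))) ∧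
        (∀ δ ≤ θ * (η l / 2), ∀ x ∈ S.grid P (H (l + 1)) ∩ P.deltaGeodesics δ,
          x ∈ S.levelGrid P H η (l + 1) ∧
          |S.levelVd P H η (l + 1) x - P.vd x| ≤ Cd * H (l + 1) ^ γ ∧
          |S.levelVs P H η (l + 1) x - P.vs x| ≤ Cs * H (l + 1) ^ γ) := by
    intro N H η hH hη l hl hlN
    obtain ⟨ζ, -, hAd, hG, hG'⟩ := levelGrid_covers hP hS hErr hCs hCd hγ
      (by linarith : 0 ≤ (1 - θ) / 4) (by linarith) hCη hκ0 hL hκ hζ₀ hA hH hη hl hlN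
    have hη0 := hAd.eta_pos
    have hζ := hAd.zeta
    have hθη : 0 < θ * η l := mul_pos hθ hη0
    have hθη1 : θ * η l < η l := by linarith [mul_lt_mul_of_pos_right hθ1 hη0]
    have hsub : ∀ η' ≤ ζ, closure (P.sublevel η') ⊆ P.Ω := fun η' h =>
      (closure_mono (sublevel_mono h)).trans hAd.closure_subset
    refine ⟨⟨closure_mono fun x hx => ⟨⟨hx.1.1, hx.2⟩, fun y hy => ?_⟩, fun δ hδ =>
      deltaGeodesics_diff_subset hP hδ (hsub _ (by linarith))⟩, fun δ hδ x hx => ?_⟩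
    · exact hG.interpolate_lt hP hS hErr hCs hCd hL hAd
        (sublevel_mono (by linarith) hx.1) (by linarith) hy
    · have h0 := hS.steps_pos _ (hH.mem (l + 1) (by omega) hlN)
      have hCOl : CO * H (l + 1) ^ γ ≤ (1 + θ) / 2 * η l := by
        have h1 := Real.rpow_le_rpow h0.le (hH.anti l hl hlN) hγ.le
        have h2 : CO * H (l + 1) ^ γ ≤ Cη / 2 * H l ^ γ :=
          mul_le_mul (by linarith) h1 (Real.rpow_nonneg h0.le γ) (by linarith)
        have h3 := hη l
        linarith
      -- The parameter lies strictly between `θ * η l`, so that `δ` is below its half, and `(1 - ε)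
      -- * η l`, the height covered by the grid of level `l + 1`.
      exact abs_error_le hP hS hErr hG' (hsub _ (by linarith)) (η := (1 + θ) / 2 * η l)
        (by linarith) (by linarith) hCOl (by linarith) hx
  refine ⟨Cη, κ, H₀, hCη, hκ0, hH₀, main, fun ε hε => ?_⟩
  -- Solves `Cd * h₀ ^ γ = ε`.
  refine ⟨(ε / Cd) ^ γ⁻¹, Real.rpow_pos_of_pos (by positivity) _, fun N H η hH hη hN δ hδ x hx => ?_⟩
  have h2 := hH.two_le
  obtain ⟨l, rfl⟩ : ∃ l, N = l + 1 := ⟨N - 1, by omega⟩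
  refine (((main _ H η hH hη l (by omega) (by omega)).2 δ hδ x hx).2.1).trans ?_
  have h0 := hS.steps_pos _ (hH.mem (l + 1) (by omega) le_rfl)
  have h1 := Real.rpow_le_rpow h0.le hN hγ.le
  rw [Real.rpow_inv_rpow (by positivity) hγ.ne'] at h1
  calc Cd * H (l + 1) ^ γ ≤ Cd * (ε / Cd) := mul_le_mul_of_nonneg_left h1 hCd.le
    _ = ε := by field_simp
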